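/- Theorem (Construction of single-shot codes). Let $C\subseteq\mathbb F_2^n$ be a classical $[n,k,d]$ binary linear code ($d=\infty$ if $k=0$). A minimal chain complex of $C$ is a parity check matrix $\delta:C_0=\mathbb F_2^n\to C_1=\mathbb F_2^{m}$ with $\ker\delta=C$ and linearly independent rows (so $m=n-k$); it always exists. Put $$\tilde\delta_{-1}=\begin{pmatrix}1\otimes\delta^T\\ \delta\otimes 1\end{pmatrix}:\ C_0\otimes C_1\to (C_0\otimes C_0)\oplus(C_1\otimes C_1),\qquad \tilde\delta_0=\begin{pmatrix}\delta\otimes1&1\otimes\delta^T\end{pmatrix}:\ (C_0\otimes C_0)\oplus(C_1\otimes C_1)\to C_1\otimes C_0,$$ write $\tilde C_{-1},\tilde C_0,\tilde C_1$ for these three spaces, and form the length-4 chain complex $\breve C_m=\bigoplus_{i-j=m}\tilde C_i\otimes\tilde C_j$ ($-2\le m\le 2$) whose boundary maps $\breve\delta_m:\breve C_m\to\breve C_{m+1}$ send $\tilde C_i\otimes\tilde C_j$ to $\tilde C_{i+1}\otimes \tilde C_j$ by $\tilde\delta_i\otimes 1$ and to $\tilde C_i\otimes\tilde C_{j-1}$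 by $1\otimes\tilde\delta_{j-1}^T$. Consider the CSS code with qubits the basis of $\breve C_0$, with the checks $Z[\breve\delta_0^T\hat u]$ and $X[\breve\delta_{-1}\hat v]$ ($\hat u$, $\hat v$ unit vectors of $\breve C_1$, $\breve C_{-1}$), and with metacheck matrix $H=\breve\delta_1\oplus\breve\delta_{-2}^T$. For a Pauli error $E$ let $\sigma(E)$ be its syndrome (entry $1$ for each check that anticommutes with $E$), $\mathrm{wt}(E)$ the number of qubits on which it acts nontrivially, and $\mathrm{wt}_{\min}(E)$ the least weight of $ES$ over stabilisers $S$; $|\cdot|$ is the Hamming weight. Let $f(x)=x^3/4$. Then, for every minimal chain complex $\delta$ of $C$: 1. This is an $[[n_Q,k^4,d_Q,d_{ss}]]$ quantum stabiliser code with $n_Q=n^4+4n^2(n-k)^2+(n-k)^4$ physical qubits, code space of dimension $2^{k^4}$, and distance $d_Q\ge d$, where $d_Q$ is the least weight of a Pauli operator that commutes with the projector onto the code space and is not (up to phase) a stabiliser ($\infty$ if there is none). Every $\sigma(E)$ satisfies $H\sigma(E)=0$, and conversely $Hs=0$ implies that $s=\sigma(E)$ for some $E$, that is, the single-shot distance $d_{ss}=\min\{|s|: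 Hs=0,\ s\notin\mathrm{im}\,\sigma\}$ is $\infty$. 2. The checks are $(d,f)$-sound: if $|\sigma(E)|<d$, there is a Pauli error $E^\star$ with $\sigma(E^\star)=\sigma(E)$ and $\mathrm{wt}(E^\star)\le f(|\sigma(E)|)$. 3. The checks are $(\tfrac d2,\tfrac d2,f)$ single-shot: there is a decoder, a map from syndromes to Pauli operators, such that for all $u$ and $E$ with $|u|<\tfrac d2$ and $f(2|u|)+\mathrm{wt}(E)<\tfrac d2$, its output $E_{\rm rec}$ on $\sigma(E)+u$ satisfies $\mathrm{wt}_{\min}(E_{\rm rec}E)\le f(2|u|)$. 4. If $k<n$ (so that there are checks), the redundancy $\upsilon$, the number of checks divided by the least number of generators of the stabiliser, satisfies $\upsilon<2$. The construction preserves the LDPC property: call a family of classical parity check matrices LDPC if their row and column weights are bounded by one constant, and a family of quantum check sets LDPC if the weights of the checks and the numbers of checks acting on a qubit are bounded by one constant. Given any sequence of classical codes with an LDPC family of parity check matrices (possibly with redundant rows), each matrix has a selection of rows that is a minimal chain complex of the code, and for all such selections the resulting quantum check family is LDPC. Finally, let $C_i$ ($i\in\mathbb N$) be $[n_i,k_i,d_i]$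 codes with $n_i\to\infty$ and $d_i\in\Omega(n_i^a)$ for some $a>0$. Then for all minimal chain complexes $\delta_i$ of $C_i$ the resulting check sets, on $N_i$ qubits, form a good single-shot family: $N_i\to\infty$, and there are a polynomial $g$, independent of $i$ and monotonically increasing on the nonnegative integers, with $g(0)=0$, numbers $p_i,q_i$, and constants $\alpha,b>0$ such that $p_i,q_i\ge \alpha N_i^b$ and the $i$-th check set is $(p_i,q_i,g)$ single-shot (as in 3, with $p_i,q_i,g$ in place of $\tfrac d2,\tfrac d2,f$). -/

import Mathlib

open scoped Matrix Kronecker ENNReal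

noncomputable section

/-! ## Pauli operators, check sets and stabiliser codes -/

/-- An `n`-qubit Pauli operator up to a phase: `(e, f)` stands for `X[e] Z[f]`.
Multiplication of Pauli operators (up to phase) is addition of pairs. -/
abbrev Pauli (Q : Type) : Type := (Q → ZMod 2) × (Q → ZMod 2)

/-- The weight: the number of qubits on which the Pauli operator acts nontrivially. -/
def pauliWt {Q : Type} [Fintype Q] (P : Pauli Q) : ℕ :=
  (Finset.univ.filter (fun q => P.1 q ≠ 0 ∨ P.2 q ≠ 0)).card

/-- The sign `(-1) ^ a` of a bit `a`. -/
def bitSign (a : ZMod 2) : ℂ := (-1) ^ a.val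

/-- The pure states of the qubits in `Q`, written in the computational basis. -/
abbrev QState (Q : Type) : Type := (Q → ZMod 2) → ℂ

/-- The Hermitian Pauli operator `⊗_q σ_q` with `σ_q ∈ {1, X, Y, Z}` represented by `(e, f)`,
as an operator on states.  Here `X[e] |x⟩ = |x + e⟩`, `Z[f] |x⟩ = (-1)^(f·x) |x⟩`, and the
factor `i` for every qubit with `e q = f q = 1` turns `X Z` into `Y`. -/
def pauliOp {Q : Type} [Fintype Q] (P : Pauli Q) : Module.End ℂ (QState Q) where
  toFun ψ x := Complex.I ^ (Finset.univ.filter (fun q => P.1 q ≠ 0 ∧ P.2 q ≠ 0)).card *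
    (bitSign (P.2 ⬝ᵥ (x + P.1)) * ψ (x + P.1))
  map_add' ψ φ := by
    funext x
    simp only [Pi.add_apply]
    ring
  map_smul' c ψ := by
    funext x
    simp only [Pi.smul_apply, smul_eq_mul, RingHom.id_apply]
    ring

/-- The bit that tells whether two Pauli operators anticommute (`1`) or commute (`0`). -/
def pauliAnti {Q : Type} [Fintype Q] (P R : Pauli Q) : ZMod 2 :=
  P.1 ⬝ᵥ R.2 + P.2 ⬝ᵥ R.1

theorem bitSign_add (a b : ZMod 2) : bitSign (a + b) = bitSign a * bitSign b := by
  have h : ∀ a b : ZMod 2, (a + b).val % 2 = (a.val + b.val) % 2 := by decide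
  unfold bitSign
  rw [← pow_add, neg_one_pow_eq_pow_mod_two, h a b, ← neg_one_pow_eq_pow_mod_two]

/-- `pauliAnti` is indeed the commutation sign of the operators. -/
theorem pauliOp_mul_pauliOp {Q : Type} [Fintype Q] (P R : Pauli Q) :
    pauliOp P * pauliOp R = bitSign (pauliAnti P R) • (pauliOp R * pauliOp P) := by
  refine LinearMap.ext fun ψ => funext fun x => ?_
  have h2 : ∀ a : ZMod 2, a + a = 0 := by decide
  have hx : x + R.1 + P.1 = x + P.1 + R.1 := by abel
  have hs : bitSign (P.2 ⬝ᵥ (x + P.1)) * bitSign (R.2 ⬝ᵥ (x + P.1 + R.1)) =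
      bitSign (pauliAnti P R) *
        (bitSign (R.2 ⬝ᵥ (x + R.1)) * bitSign (P.2 ⬝ᵥ (x + R.1 + P.1))) := by
    rw [← bitSign_add, ← bitSign_add, ← bitSign_add]
    congr 1
    simp only [pauliAnti, dotProduct_add]
    rw [dotProduct_comm P.1 R.2]
    linear_combination (-1 : ZMod 2) * h2 (P.2 ⬝ᵥ R.1)
  simp only [Module.End.mul_apply, LinearMap.smul_apply, Pi.smul_apply, smul_eq_mul]
  simp only [pauliOp, LinearMap.coe_mk, AddHom.coe_mk]
  rw [hx] at *
  linear_combination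
    (Complex.I ^ (Finset.univ.filter (fun q => P.1 q ≠ 0 ∧ P.2 q ≠ 0)).card *
      Complex.I ^ (Finset.univ.filter (fun q => R.1 q ≠ 0 ∧ R.2 q ≠ 0)).card *
      ψ (x + P.1 + R.1)) * hs

/-- The syndrome of a Pauli error `E` for the tuple of checks `M`: entry `i` is `1` exactly when
`E` anticommutes with `M i`. -/
def syndrome {Q m : Type} [Fintype Q] (M : m → Pauli Q) (E : Pauli Q) : m → ZMod 2 :=
  fun i => pauliAnti E (M i)

/-- The stabiliser (up to phases): the group generated by the checks. -/
def stabiliser {Q m : Type} (M : m → Pauli Q) : Submodule (ZMod 2) (Pauli Q) :=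
  Submodule.span (ZMod 2) (Set.range M)

/-- The code space: the joint `+1` eigenspace of the checks. -/
def codeSpace {Q m : Type} [Fintype Q] (M : m → Pauli Q) : Submodule ℂ (QState Q) where
  carrier := {ψ | ∀ i, pauliOp (M i) ψ = ψ}
  add_mem' := by
    intro a b ha hb i
    rw [map_add, ha i, hb i]
  zero_mem' := fun i => map_zero _
  smul_mem' := by
    intro c a ha i
    rw [map_smul, ha i]

/-- The Pauli operator `P` commutes with the projector onto the code space.  As `pauliOp P` is
Hermitian, this means that it maps the code space to itself. -/
def PreservesCode {Q m : Type} [Fintype Q] (M : m → Pauli Q) (P : Pauli Q) : Prop :=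
  ∀ ψ ∈ codeSpace M, pauliOp P ψ ∈ codeSpace M

/-- The min-weight: the least weight of `P S` with `S` in the stabiliser. -/
def pauliMinWt {Q m : Type} [Fintype Q] (M : m → Pauli Q) (P : Pauli Q) : ℕ :=
  sInf {w | ∃ S ∈ stabiliser M, pauliWt (P + S) = w}

/-- The qubit distance: the least weight of a Pauli operator that preserves the code space and is
not in the stabiliser (`⊤` if there is none). -/
def qubitDistance {Q m : Type} [Fintype Q] (M : m → Pauli Q) : ℕ∞ :=
  ⨅ (P : Pauli Q) (_ : PreservesCode M P ∧ P ∉ stabiliser M), (pauliWt P : ℕ∞)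

/-- The single-shot distance: the least weight of a vector that passes all the metachecks `H`
but is not a syndrome (`⊤` if there is none). -/
def singleShotDistance {Q m r : Type} [Fintype Q] [Fintype m]
    (M : m → Pauli Q) (H : Matrix r m (ZMod 2)) : ℕ∞ :=
  ⨅ (s : m → ZMod 2) (_ : H *ᵥ s = 0 ∧ s ∉ Set.range (syndrome M)), (hammingNorm s : ℕ∞)

/-- The checks `M`, with the metacheck matrix `H`, define a quantum stabiliser code with
parameters `[[N, K, D, Dss]]`. -/
structure IsQuantumCode {Q m r : Type} [Fintype Q] [Fintype m]
    (M : m → Pauli Q) (H : Matrix r m (ZMod 2)) (N K : ℕ) (D Dss : ℕ∞) : Prop where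
  /-- the stabiliser is abelian -/
  commute : ∀ i j, Commute (pauliOp (M i)) (pauliOp (M j))
  /-- ideal syndromes pass all metachecks -/
  metacheck : ∀ E, H *ᵥ syndrome M E = 0
  /-- there are `N` physical qubits -/
  physical : Fintype.card Q = N
  /-- there are `K` logical qubits -/
  logical : Module.finrank ℂ (codeSpace M) = 2 ^ K
  distance : qubitDistance M = D
  singleShot : singleShotDistance M H = Dss

/-- The redundancy of a check set: the number of checks divided by the least number of generators
of the stabiliser. -/
def redundancy {Q m : Type} [Fintype m] (M : m → Pauli Q) : ℝ :=
  (Fintype.card m : ℝ) / (Module.finrank (ZMod 2) (stabiliser M) : ℝ)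

/-! ## Soundness and single-shot error correction -/

/-- The check set `M` is `(t, f)`-sound. -/
def IsSound {Q m : Type} [Fintype Q] [Fintype m]
    (M : m → Pauli Q) (t : ℕ∞) (f : ℤ → ℝ) : Prop :=
  f 0 = 0 ∧ ∀ E : Pauli Q, (hammingNorm (syndrome M E) : ℕ∞) < t →
    ∃ E' : Pauli Q, syndrome M E' = syndrome M E ∧
      (pauliWt E' : ℝ) ≤ f (hammingNorm (syndrome M E))

/-- The check set `M` is `(p, q, f)` single-shot: there is a decoder that controls the residual
error.  (`p` and `q` may be half-integers or infinite.) -/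
def IsSingleShot {Q m : Type} [Fintype Q] [Fintype m]
    (M : m → Pauli Q) (p q : EReal) (f : ℤ → ℝ) : Prop :=
  f 0 = 0 ∧ ∃ decoder : (m → ZMod 2) → Pauli Q, ∀ (u : m → ZMod 2) (E : Pauli Q),
    ((hammingNorm u : ℝ) : EReal) < p →
    ((f (2 * (hammingNorm u : ℤ)) + (pauliWt E : ℝ) : ℝ) : EReal) < q →
    (pauliMinWt M (decoder (syndrome M E + u) + E) : ℝ) ≤ f (2 * (hammingNorm u : ℤ))

/-- A family of check sets is LDPC: for one constant, all checks have bounded weight and all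
qubits are acted on by a bounded number of checks. -/
def IsLDPC {ι : Type} {Q m : ι → Type} [∀ i, Fintype (Q i)] [∀ i, Fintype (m i)]
    (M : ∀ i, m i → Pauli (Q i)) : Prop :=
  ∃ w : ℕ, ∀ i, (∀ c, pauliWt (M i c) ≤ w) ∧
    ∀ q, (Finset.univ.filter (fun c => (M i c).1 q ≠ 0 ∨ (M i c).2 q ≠ 0)).card ≤ w

/-- An infinite family of check sets (with growing numbers of qubits) is a good single-shot
family. -/
def IsGoodSingleShotFamily {Q m : ℕ → Type} [∀ i, Fintype (Q i)] [∀ i, Fintype (m i)]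
    (M : ∀ i, m i → Pauli (Q i)) : Prop :=
  Filter.Tendsto (fun i => Fintype.card (Q i)) Filter.atTop Filter.atTop ∧
  ∃ (p q : ℕ → EReal) (f : ℤ → ℝ),
    (∃ a b : ℝ, 0 < a ∧ 0 < b ∧ ∀ i,
      ((a * (Fintype.card (Q i) : ℝ) ^ b : ℝ) : EReal) ≤ p i ∧
      ((a * (Fintype.card (Q i) : ℝ) ^ b : ℝ) : EReal) ≤ q i) ∧
    (∃ F : Polynomial ℝ, ∀ x : ℤ, f x = F.eval (x : ℝ)) ∧
    MonotoneOn f (Set.Ici 0) ∧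
    ∀ i, IsSingleShot (M i) (p i) (q i) f

/-! ## Classical codes -/

/-- The minimum distance of a binary linear code (`⊤` for the zero code). -/
def minDistance {n : ℕ} (C : Submodule (ZMod 2) (Fin n → ZMod 2)) : ℕ∞ :=
  ⨅ (x : Fin n → ZMod 2) (_ : x ∈ C ∧ x ≠ 0), (hammingNorm x : ℕ∞)

/-- `C` is an `[n, k, d]` binary linear code. -/
def IsClassicalCode {n : ℕ} (C : Submodule (ZMod 2) (Fin n → ZMod 2)) (k : ℕ) (d : ℕ∞) : Prop :=
  Module.finrank (ZMod 2) C = k ∧ minDistance C = d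

/-- `δ` is a parity check matrix of `C`, possibly with redundant rows. -/
def IsParityCheck {n m : ℕ} (δ : Matrix (Fin m) (Fin n) (ZMod 2))
    (C : Submodule (ZMod 2) (Fin n → ZMod 2)) : Prop :=
  ∀ x, x ∈ C ↔ δ *ᵥ x = 0

/-- The length-1 chain complex `δ` is minimal for `C`: a parity check matrix without redundancy. -/
def IsMinimalParityCheck {n m : ℕ} (δ : Matrix (Fin m) (Fin n) (ZMod 2))
    (C : Submodule (ZMod 2) (Fin n → ZMod 2)) : Prop :=
  IsParityCheck δ C ∧ LinearIndependent (ZMod 2) (fun i => δ i)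

/-- A family of classical parity check matrices is LDPC: row and column weights are bounded by one
constant. -/
def IsClassicalLDPC {ι : Type} {n m : ι → ℕ}
    (δ : ∀ i, Matrix (Fin (m i)) (Fin (n i)) (ZMod 2)) : Prop :=
  ∃ w : ℕ, ∀ i, (∀ c, hammingNorm (fun b => δ i c b) ≤ w) ∧
    ∀ b, hammingNorm (fun c => δ i c b) ≤ w

/-! ## The homological product

A chain complex `C_j → C_{j+1}` is given by the matrices of its boundary maps `δ_j`, whose columns
are indexed by a basis of `C_j` and whose rows are indexed by a basis of `C_{j+1}`. -/

section Single

variable {c₀ c₁ : Type} [DecidableEq c₀] [DecidableEq c₁]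

/-- First product of `δ : C₀ → C₁`: the map
`C₀ ⊗ C₁ → (C₀ ⊗ C₀) ⊕ (C₁ ⊗ C₁)`. -/
def tildeNeg1 (δ : Matrix c₁ c₀ (ZMod 2)) :
    Matrix ((c₀ × c₀) ⊕ (c₁ × c₁)) (c₀ × c₁) (ZMod 2) :=
  Matrix.fromRows ((1 : Matrix c₀ c₀ (ZMod 2)) ⊗ₖ δᵀ) (δ ⊗ₖ (1 : Matrix c₁ c₁ (ZMod 2)))

/-- First product of `δ : C₀ → C₁`: the map
`(C₀ ⊗ C₀) ⊕ (C₁ ⊗ C₁) → C₁ ⊗ C₀`. -/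
def tilde0 (δ : Matrix c₁ c₀ (ZMod 2)) :
    Matrix (c₁ × c₀) ((c₀ × c₀) ⊕ (c₁ × c₁)) (ZMod 2) :=
  Matrix.fromCols (δ ⊗ₖ (1 : Matrix c₀ c₀ (ZMod 2))) ((1 : Matrix c₁ c₁ (ZMod 2)) ⊗ₖ δᵀ)

end Single

section Double

variable {x y z : Type} [DecidableEq x] [DecidableEq y] [DecidableEq z]

/-! Second product, of the length-2 complex `A : X → Y`, `B : Y → Z` in degrees `-1, 0, 1`:
degree `-2` is `X ⊗ Z`, degree `-1` is `(X ⊗ Y) ⊕ (Y ⊗ Z)`, degree `0` is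
`(X ⊗ X) ⊕ (Y ⊗ Y) ⊕ (Z ⊗ Z)`, degree `1` is `(Y ⊗ X) ⊕ (Z ⊗ Y)`, degree `2` is `Z ⊗ X`. -/

/-- Boundary map from degree `-2` to degree `-1`. -/
def breveNeg2 (A : Matrix y x (ZMod 2)) (B : Matrix z y (ZMod 2)) :
    Matrix ((x × y) ⊕ (y × z)) (x × z) (ZMod 2) :=
  Matrix.fromRows ((1 : Matrix x x (ZMod 2)) ⊗ₖ Bᵀ) (A ⊗ₖ (1 : Matrix z z (ZMod 2)))

/-- Boundary map from degree `-1` to degree `0`. -/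
def breveNeg1 (A : Matrix y x (ZMod 2)) (B : Matrix z y (ZMod 2)) :
    Matrix ((x × x) ⊕ ((y × y) ⊕ (z × z))) ((x × y) ⊕ (y × z)) (ZMod 2) :=
  Matrix.fromRows
    (Matrix.fromCols ((1 : Matrix x x (ZMod 2)) ⊗ₖ Aᵀ) 0)
    (Matrix.fromRows
      (Matrix.fromCols (A ⊗ₖ (1 : Matrix y y (ZMod 2))) ((1 : Matrix y y (ZMod 2)) ⊗ₖ Bᵀ))
      (Matrix.fromCols 0 (B ⊗ₖ (1 : Matrix z z (ZMod 2)))))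

/-- Boundary map from degree `0` to degree `1`. -/
def breve0 (A : Matrix y x (ZMod 2)) (B : Matrix z y (ZMod 2)) :
    Matrix ((y × x) ⊕ (z × y)) ((x × x) ⊕ ((y × y) ⊕ (z × z))) (ZMod 2) :=
  Matrix.fromRows
    (Matrix.fromCols (A ⊗ₖ (1 : Matrix x x (ZMod 2)))
      (Matrix.fromCols ((1 : Matrix y y (ZMod 2)) ⊗ₖ Aᵀ) 0))
    (Matrix.fromCols 0
      (Matrix.fromCols (B ⊗ₖ (1 : Matrix y y (ZMod 2))) ((1 : Matrix z z (ZMod 2)) ⊗ₖ Bᵀ)))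

/-- Boundary map from degree `1` to degree `2`. -/
def breve1 (A : Matrix y x (ZMod 2)) (B : Matrix z y (ZMod 2)) :
    Matrix (z × x) ((y × x) ⊕ (z × y)) (ZMod 2) :=
  Matrix.fromCols (B ⊗ₖ (1 : Matrix x x (ZMod 2))) ((1 : Matrix z z (ZMod 2)) ⊗ₖ Aᵀ)

end Double

/-- The checks of the CSS code of `C₋₁ → C₀ → C₁`: the operators `Z[δ₀ᵀ û]` for the unit vectors
`û` of `C₁` and `X[δ₋₁ v̂]` for the unit vectors `v̂` of `C₋₁`. -/
def cssChecks {cm c cp : Type} (δm : Matrix c cm (ZMod 2)) (δ₀ : Matrix cp c (ZMod 2)) :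
    cp ⊕ cm → Pauli c :=
  Sum.elim (fun u => (0, fun q => δ₀ u q)) (fun v => (fun q => δm q v, 0))

/-- The qubits of the double homological product code of `δ : C₀ → C₁`. -/
abbrev DoubleQubits (c₀ c₁ : Type) : Type :=
  ((c₀ × c₁) × (c₀ × c₁)) ⊕
    ((((c₀ × c₀) ⊕ (c₁ × c₁)) × ((c₀ × c₀) ⊕ (c₁ × c₁))) ⊕ ((c₁ × c₀) × (c₁ × c₀)))

/-- The index set of the `Z` checks of the double homological product code (degree `1`). -/
abbrev DoubleZ (c₀ c₁ : Type) : Type :=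
  (((c₀ × c₀) ⊕ (c₁ × c₁)) × (c₀ × c₁)) ⊕ ((c₁ × c₀) × ((c₀ × c₀) ⊕ (c₁ × c₁)))

/-- The index set of the `X` checks of the double homological product code (degree `-1`). -/
abbrev DoubleX (c₀ c₁ : Type) : Type :=
  ((c₀ × c₁) × ((c₀ × c₀) ⊕ (c₁ × c₁))) ⊕ (((c₀ × c₀) ⊕ (c₁ × c₁)) × (c₁ × c₀))

/-- The checks of the double homological product code of `δ : C₀ → C₁`. -/
def doubleChecks {c₀ c₁ : Type} [DecidableEq c₀] [DecidableEq c₁] (δ : Matrix c₁ c₀ (ZMod 2)) :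
    DoubleZ c₀ c₁ ⊕ DoubleX c₀ c₁ → Pauli (DoubleQubits c₀ c₁) :=
  cssChecks (breveNeg1 (tildeNeg1 δ) (tilde0 δ)) (breve0 (tildeNeg1 δ) (tilde0 δ))

/-- The metacheck matrix of the double homological product code: the block diagonal matrix of
`δ₁` and `δ₋₂ᵀ`. -/
def doubleMetachecks {c₀ c₁ : Type} [DecidableEq c₀] [DecidableEq c₁]
    (δ : Matrix c₁ c₀ (ZMod 2)) :
    Matrix (((c₁ × c₀) × (c₀ × c₁)) ⊕ ((c₀ × c₁) × (c₁ × c₀)))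
      (DoubleZ c₀ c₁ ⊕ DoubleX c₀ c₁) (ZMod 2) :=
  Matrix.fromBlocks (breve1 (tildeNeg1 δ) (tilde0 δ)) 0 0
    (breveNeg2 (tildeNeg1 δ) (tilde0 δ))ᵀ

end

/-! A vector in a tensor product of two based spaces is a matrix over `ZMod 2`, and `K ⊗ 1`, `1 ⊗ K`
act on it by multiplication on the left by `K` and on the right by `Kᵀ`. In this language the first
product is `R ↦ (Rδ, δR)`, `(S, T) ↦ δS + Tδ`. With `A = tildeNeg1 δ` and `B = tilde0 δ`, the second
product is the endomorphism complex of `X → Y → Z`: a cycle `(P, Q, W)` in degree 0 is a chain map,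
and a boundary is a null-homotopic one.

All weight estimates rest on two facts. Left factors create no new nonzero columns and right factors
create no new nonzero rows; and the weight of a matrix is at most the number of its nonzero rows
times the number of its nonzero columns. Since `δ` has independent rows, it has a right inverse, and
the first product is exact at both ends. In the middle, cycles of weight below `d` are boundaries,
and `4|R| ≤ |(Rδ, δR)|²` when the right side is small (`isSoundComplex_tilde`). Matrix transposition
gives the same for the dual complex.

These properties suffice for the second product. Exactness in degree 1 (`exists_preimage`) makes the
single-shot distance infinite. A chain map with `|Q| < d` is null-homotopic (`exists_nullHomotopy`),
which bounds the qubit distance. For a syndrome `(L, M)` with `BL = MA = N`, a generalized inverse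
`G` of `N` gives the middle block `Q = LGM`, of weight at most `|L||M|`; what remains of `L` and `M`
splits into cycles of the first product with small fillings, so the preimage has at most cubic
weight (`exists_small_preimage`). The number of logical qubits is the Euler characteristic, since
all homology sits in degree 0.

Soundness and distance together make a minimum-weight decoder single-shot (`IsSound.isSingleShot`).
The LDPC statement is a count of block weights, and the family statement uses `N ≤ 6n⁴`. -/

/-! ### Arithmetic modulo 2 and weights of vectors and Pauli operators. -/

theorem ZMod.add_self_two (a : ZMod 2) : a + a = 0 := CharTwo.add_self_eq_zero a

theorem pi_add_self {ι : Type} (v : ι → ZMod 2) : v + v = 0 :=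
  funext fun i => ZMod.add_self_two (v i)

theorem pi_neg_eq {ι : Type} (v : ι → ZMod 2) : -v = v :=
  neg_eq_of_add_eq_zero_left (pi_add_self v)

theorem pauli_add_self {Q : Type} (P : Pauli Q) : P + P = 0 :=
  Prod.ext (pi_add_self P.1) (pi_add_self P.2)

theorem hammingNorm_sumElim {a b : Type} [Fintype a] [Fintype b] (u : a → ZMod 2)
    (v : b → ZMod 2) : hammingNorm (Sum.elim u v) = hammingNorm u + hammingNorm v := by
  simp only [hammingNorm, Finset.card_filter, Fintype.sum_sum_type, Sum.elim_inl, Sum.elim_inr]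
  rfl

theorem hammingNorm_add_le {a : Type} [Fintype a] (u v : a → ZMod 2) :
    hammingNorm (u + v) ≤ hammingNorm u + hammingNorm v := by
  have h := hammingDist_triangle u 0 (-v)
  rwa [hammingDist_zero_right, hammingDist_zero_left, hammingDist_eq_hammingNorm, pi_neg_eq,
    pi_neg_eq] at h

section Weight

variable {Q : Type} [Fintype Q]

theorem pauliWt_le (P : Pauli Q) : pauliWt P ≤ hammingNorm P.1 + hammingNorm P.2 := by
  classical
  unfold pauliWt hammingNorm
  rw [Finset.filter_or]
  exact Finset.card_union_le _ _

theorem hammingNorm_fst_le_pauliWt (P : Pauli Q) : hammingNorm P.1 ≤ pauliWt P :=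
  Finset.card_le_card fun q hq => by
    simp only [Finset.mem_filter, Finset.mem_univ, true_and] at hq ⊢
    exact Or.inl hq

theorem hammingNorm_snd_le_pauliWt (P : Pauli Q) : hammingNorm P.2 ≤ pauliWt P :=
  Finset.card_le_card fun q hq => by
    simp only [Finset.mem_filter, Finset.mem_univ, true_and] at hq ⊢
    exact Or.inr hq

theorem pauliWt_add_le (P R : Pauli Q) : pauliWt (P + R) ≤ pauliWt P + pauliWt R := by
  classical
  unfold pauliWt
  refine le_trans (Finset.card_le_card fun q hq => ?_) (Finset.card_union_le _ _)
  simp only [Finset.mem_filter, Finset.mem_univ, true_and, Finset.mem_union, Prod.fst_add,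
    Prod.snd_add, Pi.add_apply] at hq ⊢
  by_contra! h
  simp [h] at hq

end Weight

theorem syndrome_add {Q m : Type} [Fintype Q] (M : m → Pauli Q) (E F : Pauli Q) :
    syndrome M (E + F) = syndrome M E + syndrome M F := by
  funext i
  simp only [syndrome, pauliAnti, Prod.fst_add, Prod.snd_add, add_dotProduct, Pi.add_apply]
  ring

/-! ### CSS codes: stabiliser, syndrome and code space. -/

section Css

variable {cm c cp : Type} (δm : Matrix c cm (ZMod 2)) (δ₀ : Matrix cp c (ZMod 2))

theorem stabiliser_cssChecks [Fintype cm] [Fintype cp] :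
    stabiliser (cssChecks δm δ₀) = (LinearMap.range δm.mulVecLin).prod
      (LinearMap.range δ₀ᵀ.mulVecLin) := by
  rw [Matrix.range_mulVecLin, Matrix.range_mulVecLin, ← LinearMap.span_inl_union_inr, stabiliser,
    cssChecks, Set.Sum.elim_range, Set.union_comm, ← Set.range_comp, ← Set.range_comp]
  rfl

theorem finrank_stabiliser_cssChecks [Fintype cm] [Fintype c] [Fintype cp] :
    Module.finrank (ZMod 2) (stabiliser (cssChecks δm δ₀)) = δm.rank + δ₀.rank := by
  rw [stabiliser_cssChecks, ← Matrix.rank_transpose δ₀, Matrix.rank, Matrix.rank,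
    ← Module.finrank_prod]
  exact LinearEquiv.finrank_eq 
    { toFun := fun x => (⟨x.1.1, x.2.1⟩, ⟨x.1.2, x.2.2⟩)
      map_add' := fun _ _ => rfl
      map_smul' := fun _ _ => rfl
      invFun := fun x => ⟨(x.1.1, x.2.1), x.1.2, x.2.2⟩
      left_inv := fun _ => rfl
      right_inv := fun _ => rfl }

variable [Fintype c]

theorem syndrome_cssChecks (E : Pauli c) :
    syndrome (cssChecks δm δ₀) E = Sum.elim (δ₀ *ᵥ E.1) (δmᵀ *ᵥ E.2) := by
  funext i
  rcases i with u | v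
  · simp only [syndrome, pauliAnti, cssChecks, Sum.elim_inl, dotProduct_zero, add_zero,
      Matrix.mulVec]
    exact dotProduct_comm _ _
  · simp only [syndrome, pauliAnti, cssChecks, Sum.elim_inr, dotProduct_zero, zero_add,
      Matrix.mulVec]
    exact dotProduct_comm _ _

theorem bitSign_zero : bitSign 0 = 1 := by simp [bitSign]

theorem bitSign_eq_one_iff (a : ZMod 2) : bitSign a = 1 ↔ a = 0 := by
  have h : ∀ a : ZMod 2, a = 0 ∨ a = 1 := by decide
  rcases h a with rfl | rfl
  · simp [bitSign]
  · simp [bitSign, ZMod.val_one]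
    norm_num

/-- A `Z` check multiplies the amplitude at `x` by a sign, so it confines the support to its kernel;
an `X` check translates the argument. Code states are therefore functions on cycles that are
constant modulo boundaries. -/
theorem mem_codeSpace_cssChecks (ψ : QState c) :
    ψ ∈ codeSpace (cssChecks δm δ₀) ↔
      (∀ x, ψ x ≠ 0 → δ₀ *ᵥ x = 0) ∧ ∀ v x, ψ (x + fun q => δm q v) = ψ x := by
  constructor
  · intro h
    constructor
    · intro x hx
      funext u
      have := congrFun (h (Sum.inl u)) x
      simp only [pauliOp, cssChecks, Sum.elim_inl, LinearMap.coe_mk, AddHom.coe_mk, Pi.zero_apply,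
        ne_eq, not_true_eq_false, false_and, Finset.filter_false, Finset.card_empty, pow_zero,
        one_mul, add_zero] at this
      exact (bitSign_eq_one_iff _).1 (mul_right_cancel₀ hx (this.trans (one_mul _).symm))
    · intro v x
      have := congrFun (h (Sum.inr v)) x
      simpa [pauliOp, cssChecks, bitSign_zero] using this
  · rintro ⟨h₁, h₂⟩ (u | v)
    · funext x
      simp only [pauliOp, cssChecks, Sum.elim_inl, LinearMap.coe_mk, AddHom.coe_mk, Pi.zero_apply,
        ne_eq, not_true_eq_false, false_and, Finset.filter_false, Finset.card_empty, pow_zero,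
        one_mul, add_zero]
      by_cases hx : ψ x = 0
      · simp [hx]
      · have := congrFun (h₁ x hx) u
        exact (congrArg (· * ψ x) ((bitSign_eq_one_iff _).2 this)).trans (one_mul _)
    · funext x
      simpa [pauliOp, cssChecks, bitSign_zero] using h₂ v x

theorem codeSpace_cssChecks_invariant [Fintype cm] {ψ : QState c}
    (h : ψ ∈ codeSpace (cssChecks δm δ₀))
    (w : cm → ZMod 2) (x : c → ZMod 2) : ψ (x + δm *ᵥ w) = ψ x := by
  have hw : δm *ᵥ w ∈ Submodule.span (ZMod 2) (Set.range δm.col) := by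
    rw [← Matrix.range_mulVecLin]
    exact ⟨w, rfl⟩
  generalize δm *ᵥ w = y at hw
  revert x
  induction hw using Submodule.span_induction with
  | mem y hy =>
    obtain ⟨v, rfl⟩ := hy
    exact ((mem_codeSpace_cssChecks δm δ₀ ψ).1 h).2 v
  | zero => simp
  | add y z _ _ hy hz => intro x; rw [← add_assoc, hz, hy]
  | smul a y _ hy =>
    have ha : ∀ a : ZMod 2, a = 0 ∨ a = 1 := by decide
    rcases ha a with rfl | rfl
    · simp
    · simpa using hy

/-- The code space of a CSS code is the space of functions on the homology. -/
noncomputable def cssCodeSpaceEquiv [Fintype cm] (h : δ₀ * δm = 0) :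
    codeSpace (cssChecks δm δ₀) ≃ₗ[ℂ]
      ((LinearMap.ker δ₀.mulVecLin ⧸ (LinearMap.range δm.mulVecLin).comap
        (LinearMap.ker δ₀.mulVecLin).subtype) → ℂ) := by
  classical
  exact
  { toFun := fun ψ q => Quotient.liftOn' q (fun x => ψ.1 x.1) (by
      intro x y hxy
      rw [Submodule.quotientRel_def] at hxy
      obtain ⟨w, hw⟩ := hxy
      have hw' : x.1 = y.1 + δm *ᵥ w := by
        have : δm *ᵥ w = x.1 - y.1 := hw
        rw [this]; abel
      show ψ.1 x.1 = ψ.1 y.1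
      rw [hw', codeSpace_cssChecks_invariant δm δ₀ ψ.2])
    map_add' := by
      intro ψ φ; funext q; induction q using Quotient.inductionOn'; rfl
    map_smul' := by
      intro a ψ; funext q; induction q using Quotient.inductionOn'; rfl
    invFun := fun φ => ⟨fun x => if hx : x ∈ LinearMap.ker δ₀.mulVecLin then
        φ (Submodule.Quotient.mk ⟨x, hx⟩) else 0, by
      rw [mem_codeSpace_cssChecks]
      constructor
      · intro x hx
        by_contra hn
        exact hx (dif_neg hn)
      · intro v x
        have hv : (fun q => δm q v) = δm *ᵥ Pi.single v 1 := by
          funext q; simp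
        have hk : (fun q => δm q v) ∈ LinearMap.ker δ₀.mulVecLin := by
          rw [LinearMap.mem_ker, Matrix.mulVecLin_apply, hv, Matrix.mulVec_mulVec, h,
            Matrix.zero_mulVec]
        by_cases hx : x ∈ LinearMap.ker δ₀.mulVecLin
        · rw [dif_pos hx, dif_pos (add_mem hx hk)]
          congr 1
          rw [Submodule.Quotient.eq]
          refine ⟨Pi.single v 1, ?_⟩
          simp
          rfl
        · rw [dif_neg hx, dif_neg (fun h' => hx (by simpa using sub_mem h' hk))]⟩
    left_inv := by
      intro ψ
      apply Subtype.ext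
      funext x
      by_cases hx : x ∈ LinearMap.ker δ₀.mulVecLin
      · simp only [dif_pos hx]; rfl
      · simp only [dif_neg hx]
        by_contra hn
        exact hx (((mem_codeSpace_cssChecks δm δ₀ ψ.1).1 ψ.2).1 x (Ne.symm hn))
    right_inv := by
      intro φ
      funext q
      induction q using Quotient.inductionOn' with
      | h x => exact dif_pos x.2 }

theorem finrank_codeSpace_cssChecks [Fintype cm] (h : δ₀ * δm = 0) :
    Module.finrank ℂ (codeSpace (cssChecks δm δ₀)) =
      2 ^ (Fintype.card c - δ₀.rank - δm.rank) := by
  classical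
  have hle : LinearMap.range δm.mulVecLin ≤ LinearMap.ker δ₀.mulVecLin := by
    rintro _ ⟨w, rfl⟩
    rw [LinearMap.mem_ker, Matrix.mulVecLin_apply, Matrix.mulVecLin_apply, Matrix.mulVec_mulVec, h,
      Matrix.zero_mulVec]
  have := Fintype.ofFinite (LinearMap.ker δ₀.mulVecLin ⧸ (LinearMap.range δm.mulVecLin).comap
        (LinearMap.ker δ₀.mulVecLin).subtype)
  rw [LinearEquiv.finrank_eq (cssCodeSpaceEquiv δm δ₀ h), Module.finrank_fintype_fun_eq_card,
    Module.card_eq_pow_finrank (K := ZMod 2), ZMod.card]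
  congr 1
  have h₁ := Submodule.finrank_quotient_add_finrank ((LinearMap.range δm.mulVecLin).comap
        (LinearMap.ker δ₀.mulVecLin).subtype)
  have h₂ := LinearEquiv.finrank_eq (Submodule.comapSubtypeEquivOfLe hle)
  have h₃ := LinearMap.finrank_range_add_finrank_ker δ₀.mulVecLin
  rw [Module.finrank_fintype_fun_eq_card] at h₃
  unfold Matrix.rank
  omega

end Css

theorem pauliOp_eq_zero {Q : Type} [Fintype Q] (P : Pauli Q) (ψ : QState Q)
    (h : pauliOp P ψ = 0) : ψ = 0 := by
  have hb : ∀ a, bitSign a ≠ 0 := fun a => pow_ne_zero _ (by norm_num)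
  funext x
  have := congrFun h (x - P.1)
  simp only [pauliOp, LinearMap.coe_mk, AddHom.coe_mk, sub_add_cancel, Pi.zero_apply,
    mul_eq_zero, pow_eq_zero_iff', Complex.I_ne_zero, false_and, false_or, hb] at this
  exact this

/-- A Pauli operator that preserves a nonzero code space commutes with all checks. -/
theorem PreservesCode.syndrome_eq_zero {Q m : Type} [Fintype Q] {M : m → Pauli Q} {P : Pauli Q}
    (h : PreservesCode M P) (hM : codeSpace M ≠ ⊥) : syndrome M P = 0 := by
  obtain ⟨ψ, hψ, h0⟩ := (Submodule.ne_bot_iff _).1 hM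
  funext i
  by_contra hi
  have h1 : syndrome M P i = 1 := by
    have : ∀ a : ZMod 2, a ≠ 0 → a = 1 := by decide
    exact this _ hi
  have h2 := h ψ hψ i
  -- If `P` anticommuted with a check, that check would send `Pψ` both to itself and to `-Pψ`,
  -- forcing `Pψ = 0` although `P` is injective.
  have h3 := congrArg (fun f => f ψ) (pauliOp_mul_pauliOp P (M i))
  have h4 : pauliAnti P (M i) = 1 := h1
  simp only [Module.End.mul_apply, LinearMap.smul_apply, h2, hψ i, h4] at h3
  have h5 : bitSign 1 = -1 := by simp [bitSign, ZMod.val_one]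
  rw [h5, neg_one_smul, self_eq_neg] at h3
  exact h0 (pauliOp_eq_zero _ _ h3)

/-! ### Supports and weights of matrices. -/

section MatrixWeight

variable {a b c : Type} [Fintype a] [Fintype b] [Fintype c]

/-- The number of nonzero entries of a matrix. -/
def matWt (M : Matrix a b (ZMod 2)) : ℕ := hammingNorm fun p : a × b => M p.1 p.2

/-- The indices of the nonzero rows of a matrix. -/
def rowSupp (M : Matrix a b (ZMod 2)) : Finset a := Finset.univ.filter fun i => hammingNorm (M i) ≠ 0

theorem mem_rowSupp {M : Matrix a b (ZMod 2)} {i : a} : i ∈ rowSupp M ↔ M i ≠ 0 := by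
  simp [rowSupp, hammingNorm_eq_zero]

theorem matWt_transpose (M : Matrix a b (ZMod 2)) : matWt Mᵀ = matWt M :=
  Finset.card_equiv (Equiv.prodComm b a) fun p => by
    rw [Finset.mem_filter, Finset.mem_filter]
    exact ⟨fun h => ⟨Finset.mem_univ _, h.2⟩, fun h => ⟨Finset.mem_univ _, h.2⟩⟩

theorem matWt_eq_sum_rows (M : Matrix a b (ZMod 2)) : matWt M = ∑ i, hammingNorm (M i) := by
  simp only [matWt, hammingNorm, Finset.card_filter, Fintype.sum_prod_type]

theorem matWt_le_sum_rowSupp (M : Matrix a b (ZMod 2)) :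
    matWt M ≤ ∑ i ∈ rowSupp M, hammingNorm (M i) := by
  rw [matWt_eq_sum_rows, rowSupp, Finset.sum_filter_of_ne]
  intro i _ h
  exact h

theorem card_rowSupp_le_matWt (M : Matrix a b (ZMod 2)) : (rowSupp M).card ≤ matWt M := by
  rw [matWt_eq_sum_rows, rowSupp, Finset.card_filter]
  refine Finset.sum_le_sum fun i _ => ?_
  split_ifs with h
  · exact Nat.pos_of_ne_zero h
  · exact Nat.zero_le _

theorem hammingNorm_row_le_card_colSupp (M : Matrix a b (ZMod 2)) (i : a) :
    hammingNorm (M i) ≤ (rowSupp Mᵀ).card :=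
  Finset.card_le_card fun j hj => by
    simp only [Finset.mem_filter, Finset.mem_univ, true_and] at hj
    exact mem_rowSupp.2 fun h => hj (congrFun h i)

/-- The nonzero entries lie in the rectangle spanned by the nonzero rows and the nonzero columns.
For products, `rowSupp_mul_subset` and its transpose bound the two sides separately, by the outer
factors. -/
theorem matWt_le_card_mul_card (M : Matrix a b (ZMod 2)) :
    matWt M ≤ (rowSupp M).card * (rowSupp Mᵀ).card := by
  refine (matWt_le_sum_rowSupp M).trans ?_
  rw [← smul_eq_mul]
  exact Finset.sum_le_card_nsmul _ _ _ fun i _ => hammingNorm_row_le_card_colSupp M i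

theorem rowSupp_mul_subset (M : Matrix a b (ZMod 2)) (N : Matrix b c (ZMod 2)) :
    rowSupp (M * N) ⊆ rowSupp M := by
  intro i hi
  rw [mem_rowSupp] at hi ⊢
  contrapose! hi
  rw [Matrix.mul_apply_eq_vecMul, hi, Matrix.zero_vecMul]

end MatrixWeight

theorem matrix_add_self {a b : Type} (M : Matrix a b (ZMod 2)) : M + M = 0 :=
  Matrix.ext fun i j => ZMod.add_self_two (M i j)

theorem matrix_eq_of_add_eq_zero {a b : Type} {M N : Matrix a b (ZMod 2)} (h : M + N = 0) :
    M = N := by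
  rw [← add_zero M, ← matrix_add_self N, ← add_assoc, h, zero_add]

/-- `G` extends a section of `N` over its range to the whole space. It makes `1 + G N` over `ZMod 2`
a projector killed by `N`, with no bound on `G` itself. -/
theorem Matrix.exists_generalized_inverse {a b : Type} [Fintype a] [Fintype b] [DecidableEq a]
    [DecidableEq b] {K : Type} [Field K] (N : Matrix a b K) :
    ∃ G : Matrix b a K, N * G * N = N := by
  obtain ⟨g, hg⟩ := LinearMap.exists_rightInverse_of_surjective (Matrix.toLin' N).rangeRestrict
    (LinearMap.range_rangeRestrict _)
  obtain ⟨G, hG⟩ := g.exists_extend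
  refine ⟨LinearMap.toMatrix' G, ?_⟩
  apply Matrix.toLin'.injective
  rw [Matrix.toLin'_mul, Matrix.toLin'_mul, Matrix.toLin'_toMatrix']
  refine LinearMap.ext fun v => ?_
  have h₁ := LinearMap.congr_fun hG ((Matrix.toLin' N).rangeRestrict v)
  have h₂ := congrArg Subtype.val (LinearMap.congr_fun hg ((Matrix.toLin' N).rangeRestrict v))
  exact (congrArg (Matrix.toLin' N) h₁).trans h₂

/-! ### Sound three-term complexes and matrix equations for their endomorphism complexes. -/

/-- A complex `X → Y → Z` that is exact except in the middle, with systolic distance at least `d`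
in the middle and whose first map has a quadratic isoperimetric inequality up to weight `d`. -/
structure IsSoundComplex {x y z : Type} [Fintype x] [Fintype y] [Fintype z] [DecidableEq x]
    [DecidableEq z] (A : Matrix y x (ZMod 2)) (B : Matrix z y (ZMod 2)) (d : ℕ∞) : Prop where
  zero : B * A = 0
  leftInv : ∃ A' : Matrix x y (ZMod 2), A' * A = 1
  rightInv : ∃ B' : Matrix y z (ZMod 2), B * B' = 1
  distance : ∀ v, B *ᵥ v = 0 → (hammingNorm v : ℕ∞) < d → ∃ p, A *ᵥ p = v
  sound : ∀ p, (hammingNorm (A *ᵥ p) : ℕ∞) < d → 4 * hammingNorm p ≤ hammingNorm (A *ᵥ p) ^ 2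

namespace IsSoundComplex

variable {x y z : Type} [Fintype x] [Fintype y] [Fintype z] [DecidableEq x]
    [DecidableEq z] {A : Matrix y x (ZMod 2)} {B : Matrix z y (ZMod 2)} {d : ℕ∞}

/-- Columns of low weight that are cycles have small fillings. -/
theorem exists_filling {w : Type} [Fintype w] (h : IsSoundComplex A B d)
    (L : Matrix y w (ZMod 2)) (l t : ℕ) (hBL : B * L = 0) (hl : (l : ℕ∞) < d)
    (hrow : (rowSupp L).card ≤ l) (hcol : (rowSupp Lᵀ).card ≤ t) :
    ∃ P : Matrix x w (ZMod 2), A * P = L ∧ 4 * matWt P ≤ t * l ^ 2 := by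
  have hwt : ∀ a, hammingNorm (Lᵀ a) ≤ l := fun a =>
    (hammingNorm_row_le_card_colSupp Lᵀ a).trans (by rwa [Matrix.transpose_transpose])
  have hlt : ∀ a, (hammingNorm (Lᵀ a) : ℕ∞) < d := fun a =>
    lt_of_le_of_lt (by exact_mod_cast hwt a) hl
  have hex : ∀ a, ∃ p, A *ᵥ p = Lᵀ a := fun a =>
    h.distance _ (funext fun i => congrFun (congrFun hBL i) a) (hlt a)
  choose P hP using hex
  have hP4 : ∀ a, 4 * hammingNorm (P a) ≤ l ^ 2 := fun a => by
    have := h.sound (P a) (by rw [hP]; exact hlt a)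
    rw [hP] at this
    exact this.trans (Nat.pow_le_pow_left (hwt a) 2)
  refine ⟨(Matrix.of P)ᵀ, ?_, ?_⟩
  · ext i a
    exact congrFun (hP a) i
  · rw [matWt_transpose]
    -- A zero column of `L` has the zero filling, by soundness at weight 0; so at most `t` columns
    -- contribute, each at most `l ^ 2 / 4`.
    have hsub : rowSupp (Matrix.of P) ⊆ rowSupp Lᵀ := by
      intro a ha
      rw [mem_rowSupp] at ha ⊢
      intro h0
      have hA : A *ᵥ P a = 0 := by rw [hP]; exact h0
      have := h.sound (P a) (by rw [hP]; exact hlt a)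
      rw [hA, hammingNorm_zero] at this
      exact ha (hammingNorm_eq_zero.1 (show hammingNorm (P a) = 0 by omega))
    calc 4 * matWt (Matrix.of P) ≤ 4 * ∑ a ∈ rowSupp (Matrix.of P), hammingNorm (P a) :=
          Nat.mul_le_mul_left _ (matWt_le_sum_rowSupp _)
      _ = ∑ a ∈ rowSupp (Matrix.of P), 4 * hammingNorm (P a) := Finset.mul_sum _ _ _
      _ ≤ (rowSupp (Matrix.of P)).card * l ^ 2 := by
          rw [← smul_eq_mul (a := Finset.card _)]
          exact Finset.sum_le_card_nsmul _ _ _ fun a _ => hP4 a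
      _ ≤ t * l ^ 2 := Nat.mul_le_mul_right _ ((Finset.card_le_card hsub).trans hcol)

/-- The cubic isoperimetric inequality for the endomorphism complex. -/
theorem exists_small_preimage [DecidableEq y] (h : IsSoundComplex A B d)
    (h' : IsSoundComplex Bᵀ Aᵀ d)
    (L : Matrix y x (ZMod 2)) (M : Matrix z y (ZMod 2)) (hLM : B * L = M * A)
    (hd : ((matWt L + matWt M : ℕ) : ℕ∞) < d) :
    ∃ (P : Matrix x x (ZMod 2)) (Q : Matrix y y (ZMod 2)) (W : Matrix z z (ZMod 2)),
      A * P + Q * A = L ∧ B * Q + W * B = M ∧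
      4 * (matWt P + (matWt Q + matWt W)) ≤ (matWt L + matWt M) ^ 3 := by
  -- Write `N = BL = MA` and take `Q = LGM`. Then `L + QA = L(1 + GN)` is killed by `B` and `M + BQ
  -- = (1 + NG)M` is killed by right multiplication by `A`. Both remainders can be filled, the
  -- second in the transposed complex.
  obtain ⟨G, hG⟩ := Matrix.exists_generalized_inverse (B * L)
  have hL : (matWt L : ℕ∞) < d := lt_of_le_of_lt (by exact_mod_cast Nat.le_add_right _ _) hd
  have hM : (matWt M : ℕ∞) < d := lt_of_le_of_lt (by exact_mod_cast Nat.le_add_left _ _) hd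
  obtain ⟨P, hP, hPw⟩ := h.exists_filling (L * (1 + G * (B * L))) (matWt L) (matWt L)
    (by
      rw [← Matrix.mul_assoc, Matrix.mul_add, Matrix.mul_one, ← Matrix.mul_assoc, hG,
        matrix_add_self]) hL
    ((Finset.card_le_card (rowSupp_mul_subset _ _)).trans (card_rowSupp_le_matWt L))
    (by
      -- The remainder has `L` as a left factor and also as a right factor, so neither its nonzero
      -- rows nor its nonzero columns outnumber `matWt L`, although `G` is arbitrary.
      have : L * (1 + G * (B * L)) = (1 + L * G * B) * L := by
        simp only [Matrix.mul_add, Matrix.add_mul, Matrix.mul_one, Matrix.one_mul, Matrix.mul_assoc]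
      rw [this, Matrix.transpose_mul, ← matWt_transpose]
      exact (Finset.card_le_card (rowSupp_mul_subset _ _)).trans (card_rowSupp_le_matWt _))
  obtain ⟨W, hW, hWw⟩ := h'.exists_filling ((1 + M * A * G) * M)ᵀ (matWt M) (matWt M)
    (by
      rw [← Matrix.transpose_mul, Matrix.mul_assoc, Matrix.add_mul, Matrix.one_mul, ← hLM, hG,
        matrix_add_self, Matrix.transpose_zero]) hM
    (by
      rw [Matrix.transpose_mul, ← matWt_transpose]
      exact (Finset.card_le_card (rowSupp_mul_subset _ _)).trans (card_rowSupp_le_matWt _))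
    (by
      have : (1 + M * A * G) * M = M * (1 + A * G * M) := by
        simp only [Matrix.mul_add, Matrix.add_mul, Matrix.mul_one, Matrix.one_mul, Matrix.mul_assoc]
      rw [this, Matrix.transpose_transpose]
      exact (Finset.card_le_card (rowSupp_mul_subset _ _)).trans (card_rowSupp_le_matWt _))
  refine ⟨P, L * G * M, Wᵀ, ?_, ?_, ?_⟩
  · rw [hP, Matrix.mul_assoc _ M, ← hLM]
    simp only [Matrix.mul_add, Matrix.mul_one, Matrix.mul_assoc]
    rw [add_assoc, matrix_add_self, add_zero]
  · have : Wᵀ * B = (1 + M * A * G) * M := by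
      rw [← Matrix.transpose_transpose ((1 + M * A * G) * M), ← hW, Matrix.transpose_mul,
        Matrix.transpose_transpose]
    rw [this, ← hLM]
    simp only [Matrix.add_mul, Matrix.one_mul, Matrix.mul_assoc]
    rw [add_left_comm, matrix_add_self, add_zero]
  · have hQ : matWt (L * G * M) ≤ matWt L * matWt M := by
      refine (matWt_le_card_mul_card _).trans (Nat.mul_le_mul ?_ ?_)
      · rw [Matrix.mul_assoc]
        exact (Finset.card_le_card (rowSupp_mul_subset _ _)).trans (card_rowSupp_le_matWt L)
      · rw [Matrix.transpose_mul, ← matWt_transpose M]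
        exact (Finset.card_le_card (rowSupp_mul_subset _ _)).trans (card_rowSupp_le_matWt _)
    rw [matWt_transpose]
    generalize matWt L = l at *
    generalize matWt M = m at *
    -- The fillings cost `l ^ 3 + m ^ 3` and the middle block `4lm`. The cross terms `3lm(l + m)` of
    -- the cube absorb the latter: if `l` and `m` are positive then `l + m ≥ 2`.
    have h1 : 4 * (l * m) ≤ 3 * (l * m) * (l + m) := by
      rcases Nat.eq_zero_or_pos l with rfl | hl
      · simp
      rcases Nat.eq_zero_or_pos m with rfl | hm
      · simp
      calc 4 * (l * m) ≤ (l * m) * 6 := by omega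
        _ ≤ (l * m) * (3 * (l + m)) := Nat.mul_le_mul_left _ (by omega)
        _ = _ := by ring
    nlinarith

/-- Cycles of low weight in the endomorphism complex are boundaries. -/
theorem exists_nullHomotopy [DecidableEq y] (h : IsSoundComplex A B d) (P : Matrix x x (ZMod 2))
    (Q : Matrix y y (ZMod 2)) (W : Matrix z z (ZMod 2)) (h₁ : A * P = Q * A) (h₂ : B * Q = W * B)
    (hQ : (matWt Q : ℕ∞) < d) :
    ∃ (U : Matrix x y (ZMod 2)) (V : Matrix y z (ZMod 2)),
      U * A = P ∧ A * U + V * B = Q ∧ B * V = W := by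
  obtain ⟨A', hA⟩ := h.leftInv
  obtain ⟨B', hB⟩ := h.rightInv
  have hBB : B * (1 + B' * B) = 0 := by
    rw [Matrix.mul_add, Matrix.mul_one, ← Matrix.mul_assoc, hB, Matrix.one_mul, matrix_add_self]
  -- The homotopy `QB'` accounts for `W` and for all of `Q` except `Q(1 + B'B)`, whose columns are
  -- cycles because `BQ = WB`. They have weight at most `matWt Q < d`, so they are boundaries.
  obtain ⟨K, hK, -⟩ := h.exists_filling (Q * (1 + B' * B)) (matWt Q) _
    (by rw [← Matrix.mul_assoc, h₂, Matrix.mul_assoc, hBB, Matrix.mul_zero]) hQ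
    ((Finset.card_le_card (rowSupp_mul_subset _ _)).trans (card_rowSupp_le_matWt Q)) le_rfl
  refine ⟨K, Q * B', ?_, ?_, ?_⟩
  -- The equation for `P` holds after applying `A`, which is injective.
  · have h3 : A * (K * A) = A * P := by
      rw [← Matrix.mul_assoc, hK, Matrix.mul_assoc, Matrix.add_mul, Matrix.mul_assoc, h.zero,
        Matrix.mul_zero, add_zero, Matrix.one_mul, h₁]
    have := congrArg (A' * ·) h3
    simpa only [← Matrix.mul_assoc, hA, Matrix.one_mul] using this
  · rw [hK, Matrix.mul_add, Matrix.mul_one, ← Matrix.mul_assoc, add_assoc, matrix_add_self,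
      add_zero]
  · rw [← Matrix.mul_assoc, h₂, Matrix.mul_assoc, hB, Matrix.mul_one]

/-- The endomorphism complex is exact in degree `1`. -/
theorem exists_preimage (h : IsSoundComplex A B d) (L : Matrix y x (ZMod 2))
    (M : Matrix z y (ZMod 2)) (hLM : B * L = M * A) :
    ∃ Q : Matrix y y (ZMod 2), Q * A = L ∧ B * Q = M := by
  obtain ⟨A', hA⟩ := h.leftInv
  obtain ⟨B', hB⟩ := h.rightInv
  -- `B'M` solves the equation with `B`; the correction repairs the equation with `A` and is itself
  -- killed by `B`, since `B(L + B'MA) = BL + MA = 0`.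
  refine ⟨B' * M + (L + B' * M * A) * A', ?_, ?_⟩
  · rw [Matrix.add_mul, Matrix.mul_assoc _ A', hA, Matrix.mul_one, add_left_comm, matrix_add_self,
      add_zero]
  · rw [Matrix.mul_add, ← Matrix.mul_assoc, hB, Matrix.one_mul, ← Matrix.mul_assoc, Matrix.mul_add,
      hLM, Matrix.mul_assoc B', ← Matrix.mul_assoc B, hB, Matrix.one_mul, matrix_add_self,
      Matrix.zero_mul, add_zero]

end IsSoundComplex

/-! ### Tensors as matrices. -/

section MatrixForm

variable {a b c : Type}

/-- The vector in `a ⊗ b` given by a matrix. -/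
def tensorVec (M : Matrix a b (ZMod 2)) : a × b → ZMod 2 := fun p => M p.1 p.2

theorem tensorVec_injective {M N : Matrix a b (ZMod 2)} (h : tensorVec M = tensorVec N) :
    M = N := Matrix.ext fun i j => congrFun h (i, j)

theorem tensorVec_add (M N : Matrix a b (ZMod 2)) :
    tensorVec (M + N) = tensorVec M + tensorVec N := rfl

theorem hammingNorm_tensorVec [Fintype a] [Fintype b] (M : Matrix a b (ZMod 2)) :
    hammingNorm (tensorVec M) = matWt M := rfl

theorem kronecker_one_mulVec [Fintype b] [Fintype c] [DecidableEq c] (K : Matrix a b (ZMod 2))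
    (M : Matrix b c (ZMod 2)) :
    (K ⊗ₖ (1 : Matrix c c (ZMod 2))) *ᵥ tensorVec M = tensorVec (K * M) := by
  funext ⟨i, j⟩
  simp [Matrix.mulVec, dotProduct, Fintype.sum_prod_type, tensorVec, Matrix.mul_apply,
    Matrix.one_apply]

theorem one_kronecker_mulVec [Fintype b] [Fintype c] [DecidableEq c] (K : Matrix a b (ZMod 2))
    (M : Matrix c b (ZMod 2)) :
    ((1 : Matrix c c (ZMod 2)) ⊗ₖ K) *ᵥ tensorVec M = tensorVec (M * Kᵀ) := by
  funext ⟨i, j⟩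
  simp only [Matrix.mulVec, dotProduct, Fintype.sum_prod_type, tensorVec, Matrix.mul_apply,
    Matrix.kroneckerMap_apply, Matrix.one_apply, Matrix.transpose_apply]
  simp [mul_comm]

end MatrixForm

theorem sumElim_cases {a b : Type} (v : a ⊕ b → ZMod 2) :
    ∃ p q, v = Sum.elim p q := ⟨v ∘ Sum.inl, v ∘ Sum.inr, (Sum.elim_comp_inl_inr v).symm⟩

theorem exists_tensorVec {a b : Type} (v : a × b → ZMod 2) :
    ∃ M : Matrix a b (ZMod 2), v = tensorVec M := ⟨Matrix.of fun i j => v (i, j), rfl⟩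

/-! ### The first product is a sound complex. -/

section Tilde

variable {c₀ c₁ : Type} [Fintype c₀] [Fintype c₁] [DecidableEq c₁]
  (δ : Matrix c₁ c₀ (ZMod 2))

variable {δ} {δ' : Matrix c₀ c₁ (ZMod 2)} {d : ℕ∞}

/-- Right multiplication by `δ` loses no nonzero row, as `δ` has a right inverse. Hence `R` has
fewer than `d` nonzero rows, so each of its columns has weight below `d` and left multiplication by
`δ` loses no nonzero column. This gives `|R| ≤ lm ≤ (l + m)² / 4`, the origin of the factor 4. -/
theorem matWt_isoperimetric (hδ : δ * δ' = 1)
    (hd : ∀ v, δ *ᵥ v = 0 → (hammingNorm v : ℕ∞) < d → v = 0) (R : Matrix c₀ c₁ (ZMod 2))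
    (hR : ((matWt (R * δ) + matWt (δ * R) : ℕ) : ℕ∞) < d) :
    4 * matWt R ≤ (matWt (R * δ) + matWt (δ * R)) ^ 2 := by
  have hrow : (rowSupp R).card ≤ matWt (R * δ) := by
    have h := rowSupp_mul_subset (R * δ) δ'
    rw [Matrix.mul_assoc, hδ, Matrix.mul_one] at h
    exact (Finset.card_le_card h).trans (card_rowSupp_le_matWt _)
  have hcol : (rowSupp Rᵀ).card ≤ matWt (δ * R) := by
    rw [← matWt_transpose]
    refine (Finset.card_le_card fun j hj => ?_).trans (card_rowSupp_le_matWt _)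
    rw [mem_rowSupp] at hj ⊢
    intro h0
    refine hj (hd _ h0 (lt_of_le_of_lt ?_ hR))
    have := (hammingNorm_row_le_card_colSupp Rᵀ j).trans hrow
    exact_mod_cast this.trans (Nat.le_add_right _ _)
  have h := (matWt_le_card_mul_card R).trans (Nat.mul_le_mul hrow hcol)
  generalize matWt (R * δ) = l at *
  generalize matWt (δ * R) = m at *
  zify at *
  nlinarith [sq_nonneg ((l : ℤ) - m)]

variable (δ)

variable [DecidableEq c₀]

theorem tildeNeg1_mulVec (R : Matrix c₀ c₁ (ZMod 2)) :
    tildeNeg1 δ *ᵥ tensorVec R = Sum.elim (tensorVec (R * δ)) (tensorVec (δ * R)) := by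
  rw [tildeNeg1, Matrix.fromRows_mulVec, one_kronecker_mulVec, kronecker_one_mulVec,
    Matrix.transpose_transpose]

theorem tilde0_mulVec (S : Matrix c₀ c₀ (ZMod 2)) (T : Matrix c₁ c₁ (ZMod 2)) :
    tilde0 δ *ᵥ Sum.elim (tensorVec S) (tensorVec T) = tensorVec (δ * S + T * δ) := by
  rw [tilde0, Matrix.fromCols_mulVec_sumElim, one_kronecker_mulVec, kronecker_one_mulVec,
    Matrix.transpose_transpose, tensorVec_add]

theorem tilde0_transpose_mulVec (R : Matrix c₁ c₀ (ZMod 2)) :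
    (tilde0 δ)ᵀ *ᵥ tensorVec R = Sum.elim (tensorVec (δᵀ * R)) (tensorVec (R * δᵀ)) := by
  rw [tilde0, Matrix.transpose_fromCols, Matrix.fromRows_mulVec,
    ← Matrix.kroneckerMap_transpose, ← Matrix.kroneckerMap_transpose, Matrix.transpose_one,
    Matrix.transpose_one, Matrix.transpose_transpose, one_kronecker_mulVec, kronecker_one_mulVec]

theorem tildeNeg1_transpose_mulVec (S : Matrix c₀ c₀ (ZMod 2)) (T : Matrix c₁ c₁ (ZMod 2)) :
    (tildeNeg1 δ)ᵀ *ᵥ Sum.elim (tensorVec S) (tensorVec T) = tensorVec (S * δᵀ + δᵀ * T) := by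
  rw [tildeNeg1, Matrix.transpose_fromRows, Matrix.fromCols_mulVec_sumElim,
    ← Matrix.kroneckerMap_transpose, ← Matrix.kroneckerMap_transpose, Matrix.transpose_one,
    Matrix.transpose_one, Matrix.transpose_transpose, one_kronecker_mulVec, kronecker_one_mulVec,
    tensorVec_add]

variable {δ}

/-- `R = Sδ'` works once `S(1 + δ'δ) = 0`. The columns of that matrix lie in `ker δ` because `δS =
Tδ`, and their weight is at most the number of nonzero rows of `S`, which is below `d`. -/
theorem exists_factor_of_commute (hδ : δ * δ' = 1)
    (hd : ∀ v, δ *ᵥ v = 0 → (hammingNorm v : ℕ∞) < d → v = 0)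
    (S : Matrix c₀ c₀ (ZMod 2)) (T : Matrix c₁ c₁ (ZMod 2)) (h : δ * S + T * δ = 0)
    (hS : (matWt S : ℕ∞) < d) : ∃ R : Matrix c₀ c₁ (ZMod 2), R * δ = S ∧ δ * R = T := by
  have hc : δ * S = T * δ := matrix_eq_of_add_eq_zero h
  have h0 : S * (1 + δ' * δ) = 0 := by
    have hk : δ * (S * (1 + δ' * δ)) = 0 := by
      rw [← Matrix.mul_assoc, hc, Matrix.mul_assoc, Matrix.mul_add, Matrix.mul_one,
        ← Matrix.mul_assoc, hδ, Matrix.one_mul, matrix_add_self, Matrix.mul_zero]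
    generalize 1 + δ' * δ = N at *
    have hcol : ∀ j, (S * N)ᵀ j = 0 := fun j => by
      refine hd _ (funext fun i => congrFun (congrFun hk i) j) (lt_of_le_of_lt ?_ hS)
      have h₁ := hammingNorm_row_le_card_colSupp (S * N)ᵀ j
      rw [Matrix.transpose_transpose] at h₁
      have h₂ := Finset.card_le_card (rowSupp_mul_subset S N)
      exact Nat.cast_le.2 ((h₁.trans h₂).trans (card_rowSupp_le_matWt S))
    exact Matrix.ext fun i j => congrFun (hcol j) i
  refine ⟨S * δ', ?_, ?_⟩
  · rw [Matrix.mul_add, Matrix.mul_one, ← Matrix.mul_assoc] at h0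
    exact (matrix_eq_of_add_eq_zero h0).symm
  · rw [← Matrix.mul_assoc, hc, Matrix.mul_assoc, hδ, Matrix.mul_one]

theorem isSoundComplex_tilde (hδ : δ * δ' = 1)
    (hd : ∀ v, δ *ᵥ v = 0 → (hammingNorm v : ℕ∞) < d → v = 0) :
    IsSoundComplex (tildeNeg1 δ) (tilde0 δ) d where
  zero := by
    rw [tildeNeg1, tilde0, Matrix.fromCols_mul_fromRows, ← Matrix.mul_kronecker_mul,
      ← Matrix.mul_kronecker_mul, Matrix.mul_one, Matrix.one_mul, Matrix.one_mul, Matrix.mul_one,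
      matrix_add_self]
  leftInv := ⟨Matrix.fromCols ((1 : Matrix c₀ c₀ (ZMod 2)) ⊗ₖ δ'ᵀ) 0, by
    rw [tildeNeg1, Matrix.fromCols_mul_fromRows, ← Matrix.mul_kronecker_mul, ← Matrix.transpose_mul,
      hδ, Matrix.zero_mul, add_zero, Matrix.one_mul, Matrix.transpose_one, Matrix.one_kronecker_one]⟩
  rightInv := ⟨Matrix.fromRows (δ' ⊗ₖ (1 : Matrix c₀ c₀ (ZMod 2))) 0, by
    rw [tilde0, Matrix.fromCols_mul_fromRows, ← Matrix.mul_kronecker_mul, hδ, Matrix.mul_zero,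
      add_zero, Matrix.one_mul, Matrix.one_kronecker_one]⟩
  distance := by
    intro v h hv
    obtain ⟨s, t, rfl⟩ := sumElim_cases v
    obtain ⟨S, rfl⟩ := exists_tensorVec s
    obtain ⟨T, rfl⟩ := exists_tensorVec t
    rw [tilde0_mulVec] at h
    rw [hammingNorm_sumElim, hammingNorm_tensorVec, hammingNorm_tensorVec] at hv
    obtain ⟨R, rfl, rfl⟩ := exists_factor_of_commute hδ hd S T (tensorVec_injective h)
      (lt_of_le_of_lt (by exact_mod_cast Nat.le_add_right _ _) hv)
    exact ⟨tensorVec R, tildeNeg1_mulVec δ R⟩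
  sound := by
    intro p hp
    obtain ⟨R, rfl⟩ := exists_tensorVec p
    rw [tildeNeg1_mulVec, hammingNorm_sumElim, hammingNorm_tensorVec, hammingNorm_tensorVec] at *
    exact matWt_isoperimetric hδ hd R hp

/-- Transposing the matrices that represent tensors turns the dual complex into the original one:
`(δᵀR)ᵀ = Rᵀδ` and `(Rδᵀ)ᵀ = δRᵀ`. So no property of the code of `δᵀ` enters. -/
theorem isSoundComplex_tilde_transpose (hδ : δ * δ' = 1)
    (hd : ∀ v, δ *ᵥ v = 0 → (hammingNorm v : ℕ∞) < d → v = 0) :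
    IsSoundComplex (tilde0 δ)ᵀ (tildeNeg1 δ)ᵀ d where
  zero := by
    rw [← Matrix.transpose_mul, (isSoundComplex_tilde hδ hd).zero, Matrix.transpose_zero]
  leftInv := by
    obtain ⟨B, hB⟩ := (isSoundComplex_tilde hδ hd).rightInv
    exact ⟨Bᵀ, by rw [← Matrix.transpose_mul, hB, Matrix.transpose_one]⟩
  rightInv := by
    obtain ⟨A, hA⟩ := (isSoundComplex_tilde hδ hd).leftInv
    exact ⟨Aᵀ, by rw [← Matrix.transpose_mul, hA, Matrix.transpose_one]⟩
  distance := by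
    intro v h hv
    obtain ⟨s, t, rfl⟩ := sumElim_cases v
    obtain ⟨S, rfl⟩ := exists_tensorVec s
    obtain ⟨T, rfl⟩ := exists_tensorVec t
    rw [tildeNeg1_transpose_mulVec] at h
    rw [hammingNorm_sumElim, hammingNorm_tensorVec, hammingNorm_tensorVec] at hv
    have h' := congrArg Matrix.transpose (tensorVec_injective (N := 0) h)
    rw [Matrix.transpose_add, Matrix.transpose_mul, Matrix.transpose_mul,
      Matrix.transpose_transpose, Matrix.transpose_zero] at h'
    obtain ⟨R, hS, hT⟩ := exists_factor_of_commute hδ hd Sᵀ Tᵀ h'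
      (lt_of_le_of_lt (by rw [matWt_transpose]; exact_mod_cast Nat.le_add_right _ _) hv)
    refine ⟨tensorVec Rᵀ, ?_⟩
    rw [tilde0_transpose_mulVec, ← Matrix.transpose_mul, ← Matrix.transpose_mul, hS, hT,
      Matrix.transpose_transpose, Matrix.transpose_transpose]
  sound := by
    intro p hp
    obtain ⟨R, rfl⟩ := exists_tensorVec p
    have h₁ : matWt (δᵀ * R) = matWt (Rᵀ * δ) := by
      rw [← matWt_transpose, Matrix.transpose_mul, Matrix.transpose_transpose]
    have h₂ : matWt (R * δᵀ) = matWt (δ * Rᵀ) := by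
      rw [← matWt_transpose, Matrix.transpose_mul, Matrix.transpose_transpose]
    simp only [tilde0_transpose_mulVec, hammingNorm_sumElim, hammingNorm_tensorVec, h₁, h₂] at hp ⊢
    rw [← matWt_transpose]
    exact matWt_isoperimetric hδ hd Rᵀ hp

end Tilde

theorem exists_tensorVec_triple {x y z : Type} (v : (x × x) ⊕ ((y × y) ⊕ (z × z)) → ZMod 2) :
    ∃ (P : Matrix x x (ZMod 2)) (Q : Matrix y y (ZMod 2)) (W : Matrix z z (ZMod 2)),
      v = Sum.elim (tensorVec P) (Sum.elim (tensorVec Q) (tensorVec W)) := by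
  obtain ⟨p, v', rfl⟩ := sumElim_cases v
  obtain ⟨q, w, rfl⟩ := sumElim_cases v'
  exact ⟨Matrix.of fun i j => p (i, j), Matrix.of fun i j => q (i, j),
    Matrix.of fun i j => w (i, j), rfl⟩

theorem exists_tensorVec_pair {a b c e : Type} (v : (a × b) ⊕ (c × e) → ZMod 2) :
    ∃ (L : Matrix a b (ZMod 2)) (M : Matrix c e (ZMod 2)),
      v = Sum.elim (tensorVec L) (tensorVec M) := by
  obtain ⟨p, q, rfl⟩ := sumElim_cases v
  exact ⟨Matrix.of fun i j => p (i, j), Matrix.of fun i j => q (i, j), rfl⟩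

/-! ### The second product as an endomorphism complex: exactness, distance, soundness and ranks. -/

section Breve

variable {x y z : Type} [Fintype x] [Fintype y] [Fintype z] [DecidableEq x]
  [DecidableEq z] (A : Matrix y x (ZMod 2)) (B : Matrix z y (ZMod 2))

theorem breve1_mulVec (L : Matrix y x (ZMod 2)) (M : Matrix z y (ZMod 2)) :
    breve1 A B *ᵥ Sum.elim (tensorVec L) (tensorVec M) = tensorVec (B * L + M * A) := by
  simp only [breve1, Matrix.fromCols_mulVec_sumElim, one_kronecker_mulVec, kronecker_one_mulVec,
    Matrix.transpose_transpose, tensorVec_add]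

theorem breveNeg2_transpose_mulVec (U : Matrix x y (ZMod 2)) (V : Matrix y z (ZMod 2)) :
    (breveNeg2 A B)ᵀ *ᵥ Sum.elim (tensorVec U) (tensorVec V) = tensorVec (Aᵀ * V + U * Bᵀ) := by
  simp only [breveNeg2, Matrix.transpose_fromRows, Matrix.fromCols_mulVec_sumElim,
    ← Matrix.kroneckerMap_transpose, Matrix.transpose_one, one_kronecker_mulVec,
    kronecker_one_mulVec, Matrix.transpose_transpose, tensorVec_add]
  rw [add_comm]

variable [DecidableEq y]

theorem breve0_mulVec (P : Matrix x x (ZMod 2)) (Q : Matrix y y (ZMod 2))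
    (W : Matrix z z (ZMod 2)) :
    breve0 A B *ᵥ Sum.elim (tensorVec P) (Sum.elim (tensorVec Q) (tensorVec W)) =
      Sum.elim (tensorVec (A * P + Q * A)) (tensorVec (B * Q + W * B)) := by
  simp only [breve0, Matrix.fromRows_mulVec, Matrix.fromCols_mulVec_sumElim, one_kronecker_mulVec,
    kronecker_one_mulVec, Matrix.transpose_transpose, Matrix.zero_mulVec, add_zero, zero_add,
    tensorVec_add]

theorem breveNeg1_mulVec (U : Matrix x y (ZMod 2)) (V : Matrix y z (ZMod 2)) :
    breveNeg1 A B *ᵥ Sum.elim (tensorVec U) (tensorVec V) =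
      Sum.elim (tensorVec (U * A)) (Sum.elim (tensorVec (A * U + V * B)) (tensorVec (B * V))) := by
  simp only [breveNeg1, Matrix.fromRows_mulVec, Matrix.fromCols_mulVec_sumElim,
    one_kronecker_mulVec, kronecker_one_mulVec, Matrix.transpose_transpose, Matrix.zero_mulVec,
    add_zero, zero_add, tensorVec_add]

theorem breve0_transpose_mulVec (L : Matrix y x (ZMod 2)) (M : Matrix z y (ZMod 2)) :
    (breve0 A B)ᵀ *ᵥ Sum.elim (tensorVec L) (tensorVec M) =
      Sum.elim (tensorVec (Aᵀ * L))
        (Sum.elim (tensorVec (Bᵀ * M + L * Aᵀ)) (tensorVec (M * Bᵀ))) := by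
  simp only [breve0, Matrix.transpose_fromRows, Matrix.transpose_fromCols, Matrix.fromRows_mulVec,
    Matrix.fromCols_mulVec_sumElim, ← Matrix.kroneckerMap_transpose, Matrix.transpose_one,
    one_kronecker_mulVec, kronecker_one_mulVec, Matrix.transpose_transpose, Matrix.transpose_zero,
    Matrix.zero_mulVec, ← Sum.elim_add_add, add_zero, zero_add, tensorVec_add]
  rw [add_comm (tensorVec (L * Aᵀ))]

theorem breveNeg1_transpose_mulVec (P : Matrix x x (ZMod 2)) (Q : Matrix y y (ZMod 2))
    (W : Matrix z z (ZMod 2)) :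
    (breveNeg1 A B)ᵀ *ᵥ Sum.elim (tensorVec P) (Sum.elim (tensorVec Q) (tensorVec W)) =
      Sum.elim (tensorVec (Aᵀ * Q + P * Aᵀ)) (tensorVec (Bᵀ * W + Q * Bᵀ)) := by
  simp only [breveNeg1, Matrix.transpose_fromRows, Matrix.transpose_fromCols,
    Matrix.fromRows_mulVec, Matrix.fromCols_mulVec_sumElim, ← Matrix.kroneckerMap_transpose,
    Matrix.transpose_one, one_kronecker_mulVec, kronecker_one_mulVec, Matrix.transpose_transpose,
    Matrix.transpose_zero, Matrix.zero_mulVec, ← Sum.elim_add_add, add_zero, zero_add, tensorVec_add]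
  rw [add_comm (tensorVec (P * Aᵀ)), add_comm (tensorVec (Q * Bᵀ))]

variable {A B} {d : ℕ∞}

theorem breve0_mul_breveNeg1 (h : B * A = 0) : breve0 A B * breveNeg1 A B = 0 := by
  apply Matrix.mulVec_injective
  funext v
  obtain ⟨U, V, rfl⟩ := exists_tensorVec_pair v
  rw [← Matrix.mulVec_mulVec, breveNeg1_mulVec, breve0_mulVec, Matrix.add_mul, Matrix.mul_add, ← Matrix.mul_assoc B, ← Matrix.mul_assoc B, h,
    Matrix.mul_assoc V B A, h, Matrix.zero_mul, Matrix.mul_zero, add_zero, zero_add,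
    ← Matrix.mul_assoc A U A, Matrix.mul_assoc B V B, matrix_add_self, matrix_add_self,
    Matrix.zero_mulVec]
  funext i
  rcases i with i | i <;> rfl

theorem breve1_mul_breve0 (h : B * A = 0) : breve1 A B * breve0 A B = 0 := by
  apply Matrix.mulVec_injective
  funext v
  obtain ⟨P, Q, W, rfl⟩ := exists_tensorVec_triple v
  rw [← Matrix.mulVec_mulVec, breve0_mulVec, breve1_mulVec, Matrix.mul_add, Matrix.add_mul,
    ← Matrix.mul_assoc B, h, Matrix.mul_assoc W, h, Matrix.zero_mul, Matrix.mul_zero, add_zero,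
    zero_add, ← Matrix.mul_assoc B, matrix_add_self, Matrix.zero_mulVec]
  rfl

theorem breveNeg1_mul_breveNeg2 (h : B * A = 0) :
    (breveNeg2 A B)ᵀ * (breveNeg1 A B)ᵀ = 0 := by
  have h' : Aᵀ * Bᵀ = 0 := by rw [← Matrix.transpose_mul, h, Matrix.transpose_zero]
  apply Matrix.mulVec_injective
  funext v
  obtain ⟨P, Q, W, rfl⟩ := exists_tensorVec_triple v
  rw [← Matrix.mulVec_mulVec, breveNeg1_transpose_mulVec, breveNeg2_transpose_mulVec,
    Matrix.mul_add, Matrix.add_mul, ← Matrix.mul_assoc Aᵀ, h', Matrix.mul_assoc P, h',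
    Matrix.zero_mul, Matrix.mul_zero, add_zero,
    zero_add, ← Matrix.mul_assoc Aᵀ, matrix_add_self, Matrix.zero_mulVec]
  rfl

namespace IsSoundComplex

theorem breve1_exact (h : IsSoundComplex A B d) (s : (y × x) ⊕ (z × y) → ZMod 2)
    (hs : breve1 A B *ᵥ s = 0) : ∃ e, breve0 A B *ᵥ e = s := by
  obtain ⟨L, M, rfl⟩ := exists_tensorVec_pair s
  rw [breve1_mulVec] at hs
  obtain ⟨Q, rfl, rfl⟩ := h.exists_preimage L M
    (matrix_eq_of_add_eq_zero (tensorVec_injective (N := 0) hs))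
  refine ⟨Sum.elim (tensorVec 0) (Sum.elim (tensorVec Q) (tensorVec 0)), ?_⟩
  rw [breve0_mulVec, Matrix.mul_zero, Matrix.zero_mul, zero_add, add_zero]

/-- The dual of the endomorphism complex of `A, B` is that of `Bᵀ, Aᵀ` with the direct summands in
reverse order. This explains the swapped arguments here and in the other dual statements. -/
theorem breveNeg2_exact (h' : IsSoundComplex Bᵀ Aᵀ d) (s : (x × y) ⊕ (y × z) → ZMod 2)
    (hs : (breveNeg2 A B)ᵀ *ᵥ s = 0) : ∃ e, (breveNeg1 A B)ᵀ *ᵥ e = s := by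
  obtain ⟨L, M, rfl⟩ := exists_tensorVec_pair s
  rw [breveNeg2_transpose_mulVec] at hs
  obtain ⟨Q, rfl, rfl⟩ := h'.exists_preimage M L
    (matrix_eq_of_add_eq_zero (tensorVec_injective (N := 0) hs))
  refine ⟨Sum.elim (tensorVec 0) (Sum.elim (tensorVec Q) (tensorVec 0)), ?_⟩
  rw [breveNeg1_transpose_mulVec, Matrix.mul_zero, Matrix.zero_mul, zero_add, add_zero]

theorem breve0_distance (h : IsSoundComplex A B d) (e : (x × x) ⊕ ((y × y) ⊕ (z × z)) → ZMod 2)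
    (he : breve0 A B *ᵥ e = 0) (hd : (hammingNorm e : ℕ∞) < d) :
    ∃ w, breveNeg1 A B *ᵥ w = e := by
  obtain ⟨P, Q, W, rfl⟩ := exists_tensorVec_triple e
  rw [breve0_mulVec] at he
  rw [hammingNorm_sumElim, hammingNorm_sumElim, hammingNorm_tensorVec, hammingNorm_tensorVec,
    hammingNorm_tensorVec] at hd
  obtain ⟨U, V, rfl, rfl, rfl⟩ := h.exists_nullHomotopy P Q W
    (matrix_eq_of_add_eq_zero (tensorVec_injective (N := 0) (congrArg (· ∘ Sum.inl) he)))
    (matrix_eq_of_add_eq_zero (tensorVec_injective (N := 0) (congrArg (· ∘ Sum.inr) he)))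
    (lt_of_le_of_lt (Nat.cast_le.2 (by omega)) hd)
  exact ⟨_, breveNeg1_mulVec A B U V⟩

theorem breveNeg1_distance (h' : IsSoundComplex Bᵀ Aᵀ d)
    (e : (x × x) ⊕ ((y × y) ⊕ (z × z)) → ZMod 2)
    (he : (breveNeg1 A B)ᵀ *ᵥ e = 0) (hd : (hammingNorm e : ℕ∞) < d) :
    ∃ w, (breve0 A B)ᵀ *ᵥ w = e := by
  obtain ⟨P, Q, W, rfl⟩ := exists_tensorVec_triple e
  rw [breveNeg1_transpose_mulVec] at he
  rw [hammingNorm_sumElim, hammingNorm_sumElim, hammingNorm_tensorVec, hammingNorm_tensorVec,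
    hammingNorm_tensorVec] at hd
  obtain ⟨U, V, rfl, rfl, rfl⟩ := h'.exists_nullHomotopy W Q P
    (matrix_eq_of_add_eq_zero (tensorVec_injective (N := 0) (congrArg (· ∘ Sum.inr) he)))
    (matrix_eq_of_add_eq_zero (tensorVec_injective (N := 0) (congrArg (· ∘ Sum.inl) he)))
    (lt_of_le_of_lt (Nat.cast_le.2 (by omega)) hd)
  exact ⟨_, (breve0_transpose_mulVec A B V U)⟩

theorem breve0_sound (h : IsSoundComplex A B d) (h' : IsSoundComplex Bᵀ Aᵀ d)
    (e : (x × x) ⊕ ((y × y) ⊕ (z × z)) → ZMod 2)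
    (hd : (hammingNorm (breve0 A B *ᵥ e) : ℕ∞) < d) :
    ∃ e', breve0 A B *ᵥ e' = breve0 A B *ᵥ e ∧
      4 * hammingNorm e' ≤ hammingNorm (breve0 A B *ᵥ e) ^ 3 := by
  have hz : breve1 A B *ᵥ (breve0 A B *ᵥ e) = 0 := by
    rw [Matrix.mulVec_mulVec, breve1_mul_breve0 h.zero, Matrix.zero_mulVec]
  generalize breve0 A B *ᵥ e = s at *
  obtain ⟨L, M, rfl⟩ := exists_tensorVec_pair s
  rw [breve1_mulVec] at hz
  rw [hammingNorm_sumElim, hammingNorm_tensorVec, hammingNorm_tensorVec] at *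
  obtain ⟨P, Q, W, rfl, rfl, hw⟩ := h.exists_small_preimage h' L M
    (matrix_eq_of_add_eq_zero (tensorVec_injective (N := 0) hz)) hd
  refine ⟨_, breve0_mulVec A B P Q W, ?_⟩
  rwa [hammingNorm_sumElim, hammingNorm_sumElim, hammingNorm_tensorVec, hammingNorm_tensorVec,
    hammingNorm_tensorVec]

theorem breveNeg1_sound (h : IsSoundComplex A B d) (h' : IsSoundComplex Bᵀ Aᵀ d)
    (e : (x × x) ⊕ ((y × y) ⊕ (z × z)) → ZMod 2)
    (hd : (hammingNorm ((breveNeg1 A B)ᵀ *ᵥ e) : ℕ∞) < d) :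
    ∃ e', (breveNeg1 A B)ᵀ *ᵥ e' = (breveNeg1 A B)ᵀ *ᵥ e ∧
      4 * hammingNorm e' ≤ hammingNorm ((breveNeg1 A B)ᵀ *ᵥ e) ^ 3 := by
  have hz : (breveNeg2 A B)ᵀ *ᵥ ((breveNeg1 A B)ᵀ *ᵥ e) = 0 := by
    rw [Matrix.mulVec_mulVec, breveNeg1_mul_breveNeg2 h.zero, Matrix.zero_mulVec]
  generalize (breveNeg1 A B)ᵀ *ᵥ e = s at *
  obtain ⟨L, M, rfl⟩ := exists_tensorVec_pair s
  rw [breveNeg2_transpose_mulVec] at hz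
  rw [hammingNorm_sumElim, hammingNorm_tensorVec, hammingNorm_tensorVec,
    add_comm (matWt L)] at *
  obtain ⟨P, Q, W, rfl, rfl, hw⟩ := h'.exists_small_preimage
    (by rwa [Matrix.transpose_transpose, Matrix.transpose_transpose]) M L
    (matrix_eq_of_add_eq_zero (tensorVec_injective (N := 0) hz)) hd
  refine ⟨_, breveNeg1_transpose_mulVec A B W Q P, ?_⟩
  rw [hammingNorm_sumElim, hammingNorm_sumElim, hammingNorm_tensorVec, hammingNorm_tensorVec,
    hammingNorm_tensorVec]
  omega

/-- By exactness in degree 1 the rank is the dimension of the kernel of `breve1`, and `breve1` is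
onto because `B` is. -/
theorem rank_breve0 (h : IsSoundComplex A B d) :
    (breve0 A B).rank + Fintype.card z * Fintype.card x =
      Fintype.card y * Fintype.card x + Fintype.card z * Fintype.card y := by
  obtain ⟨B', hB⟩ := h.rightInv
  have hker : LinearMap.range (breve0 A B).mulVecLin = LinearMap.ker (breve1 A B).mulVecLin := by
    ext s
    constructor
    · rintro ⟨e, rfl⟩
      rw [LinearMap.mem_ker, Matrix.mulVecLin_apply, Matrix.mulVecLin_apply, Matrix.mulVec_mulVec,
        breve1_mul_breve0 h.zero, Matrix.zero_mulVec]
    · exact h.breve1_exact s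
  have hsurj : LinearMap.range (breve1 A B).mulVecLin = ⊤ := by
    rw [LinearMap.range_eq_top]
    intro v
    obtain ⟨K, rfl⟩ := exists_tensorVec v
    refine ⟨Sum.elim (tensorVec (B' * K)) (tensorVec 0), ?_⟩
    rw [Matrix.mulVecLin_apply, breve1_mulVec, ← Matrix.mul_assoc, hB, Matrix.one_mul,
      Matrix.zero_mul, add_zero]
  have := LinearMap.finrank_range_add_finrank_ker (breve1 A B).mulVecLin
  rw [hsurj, finrank_top, ← hker, Module.finrank_fintype_fun_eq_card,
    Module.finrank_fintype_fun_eq_card, Fintype.card_sum, Fintype.card_prod, Fintype.card_prod,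
    Fintype.card_prod] at this
  rw [Matrix.rank]
  omega

theorem rank_breveNeg1 (h : IsSoundComplex A B d) (h' : IsSoundComplex Bᵀ Aᵀ d) :
    (breveNeg1 A B).rank + Fintype.card x * Fintype.card z =
      Fintype.card x * Fintype.card y + Fintype.card y * Fintype.card z := by
  obtain ⟨A', hA⟩ := h'.rightInv
  have hker : LinearMap.range (breveNeg1 A B)ᵀ.mulVecLin =
      LinearMap.ker (breveNeg2 A B)ᵀ.mulVecLin := by
    ext s
    constructor
    · rintro ⟨e, rfl⟩
      rw [LinearMap.mem_ker, Matrix.mulVecLin_apply, Matrix.mulVecLin_apply, Matrix.mulVec_mulVec,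
        breveNeg1_mul_breveNeg2 h.zero, Matrix.zero_mulVec]
    · exact h'.breveNeg2_exact s
  have hsurj : LinearMap.range (breveNeg2 A B)ᵀ.mulVecLin = ⊤ := by
    rw [LinearMap.range_eq_top]
    intro v
    obtain ⟨K, rfl⟩ := exists_tensorVec v
    refine ⟨Sum.elim (tensorVec 0) (tensorVec (A' * K)), ?_⟩
    rw [Matrix.mulVecLin_apply, breveNeg2_transpose_mulVec, ← Matrix.mul_assoc, hA, Matrix.one_mul,
      Matrix.zero_mul, add_zero]
  have := LinearMap.finrank_range_add_finrank_ker (breveNeg2 A B)ᵀ.mulVecLin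
  rw [hsurj, finrank_top, ← hker, Module.finrank_fintype_fun_eq_card,
    Module.finrank_fintype_fun_eq_card, Fintype.card_sum, Fintype.card_prod, Fintype.card_prod,
    Fintype.card_prod] at this
  rw [← Matrix.rank_transpose, Matrix.rank]
  omega

end IsSoundComplex

end Breve

/-! ### From soundness to single-shot decoding. -/

theorem natCast_lt_of_coe_lt_half {D : ℕ∞} {r : ℝ} {w : ℕ}
    (h : (r : EReal) < ((D : ℝ≥0∞) : EReal) / 2) (hw : (w : ℝ) ≤ 2 * r) : (w : ℕ∞) < D := by
  induction D using ENat.recTopCoe with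
  | top => exact ENat.natCast_lt_top w
  | coe n =>
    have h2 : ((2 : ℝ) : EReal) = 2 := rfl
    have hn : (((n : ℕ∞) : ℝ≥0∞) : EReal) = ((n : ℝ) : EReal) := by
      rw [ENat.toENNReal_coe]
      rfl
    rw [hn, ← h2, ← EReal.coe_div, EReal.coe_lt_coe_iff] at h
    have : (w : ℝ) < n := by linarith
    exact_mod_cast this

theorem monotoneOn_cube_div_four : MonotoneOn (fun x : ℤ => (x : ℝ) ^ 3 / 4) (Set.Ici 0) := by
  intro a ha b _ hab
  have h0 : (0 : ℝ) ≤ a := by exact_mod_cast ha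
  have h1 : (a : ℝ) ≤ b := by exact_mod_cast hab
  exact div_le_div_of_nonneg_right (pow_le_pow_left₀ h0 h1 3) (by norm_num)

/-- Soundness and distance give single-shot error correction by the minimum-weight decoder. -/
theorem IsSound.isSingleShot {Q m : Type} [Fintype Q] [Fintype m] {M : m → Pauli Q} {D : ℕ∞}
    {f : ℤ → ℝ} (hs : IsSound M D f) (hf : MonotoneOn f (Set.Ici 0))
    (hD : ∀ E, syndrome M E = 0 → (pauliWt E : ℕ∞) < D → E ∈ stabiliser M) :
    IsSingleShot M (((D : ℝ≥0∞) : EReal) / 2) (((D : ℝ≥0∞) : EReal) / 2) f := by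
  -- The decoder minimises twice: first the distance from `s` to an attainable syndrome, then the
  -- weight of an error with that syndrome.
  have hdec : ∀ s : m → ZMod 2, ∃ R : Pauli Q,
      (∀ E, hammingNorm (s + syndrome M R) ≤ hammingNorm (s + syndrome M E)) ∧
      ∀ E, syndrome M E = syndrome M R → pauliWt R ≤ pauliWt E := by
    intro s
    obtain ⟨R₀, hR₀⟩ := Finite.exists_min fun R : Pauli Q => hammingNorm (s + syndrome M R)
    have : Nonempty {R // syndrome M R = syndrome M R₀} := ⟨⟨R₀, rfl⟩⟩
    obtain ⟨⟨R, hR⟩, hmin⟩ := Finite.exists_min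
      fun R : {R // syndrome M R = syndrome M R₀} => pauliWt R.1
    refine ⟨R, fun E => by rw [hR]; exact hR₀ E, fun E hE => hmin ⟨E, hE.trans hR⟩⟩
  choose dec hdec₁ hdec₂ using hdec
  refine ⟨hs.1, dec, fun u E hu hE => ?_⟩
  have h₁ := hdec₁ (syndrome M E + u) E
  have h₂ := hdec₂ (syndrome M E + u)
  generalize dec (syndrome M E + u) = R at *
  rw [add_right_comm _ u (syndrome M E), pi_add_self, zero_add] at h₁
  have hsyn : syndrome M (R + E) = syndrome M E + u + syndrome M R + u := by
    rw [syndrome_add, add_right_comm (syndrome M E + u), add_assoc (syndrome M E), pi_add_self,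
      add_zero, add_comm]
  -- The true error shows that a syndrome repair of weight at most `|u|` exists, so the chosen
  -- repair plus `u` has weight at most `2|u|`.
  have hnorm : hammingNorm (syndrome M (R + E)) ≤ 2 * hammingNorm u := by
    rw [hsyn]
    have := hammingNorm_add_le (syndrome M E + u + syndrome M R) u
    omega
  obtain ⟨F, hF, hFw⟩ := hs.2 (R + E) (natCast_lt_of_coe_lt_half hu (by exact_mod_cast hnorm))
  have hFu : (pauliWt F : ℝ) ≤ f (2 * (hammingNorm u : ℤ)) :=
    hFw.trans (hf (Set.mem_Ici.2 (by positivity)) (Set.mem_Ici.2 (by positivity))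
      (by exact_mod_cast hnorm))
  -- `E + F` has the syndrome of `R`, so minimality gives `wt R ≤ wt E + wt F`. Then `R + E + F` has
  -- trivial syndrome and weight at most `2(wt E + wt F) < D`, so it is a stabiliser and `F` is the
  -- residual error.
  have hR := h₂ (E + F) (by
    rw [syndrome_add, hF, syndrome_add, add_left_comm, pi_add_self, add_zero])
  have hmem : R + E + F ∈ stabiliser M := by
    refine hD _ (by rw [syndrome_add, hF, pi_add_self]) (natCast_lt_of_coe_lt_half hE ?_)
    have h₃ := pauliWt_add_le R (E + F)
    have h₄ := pauliWt_add_le E F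
    rw [← add_assoc] at h₃
    have h₅ : (pauliWt (R + E + F) : ℝ) ≤ 2 * (pauliWt E + pauliWt F) := by
      exact_mod_cast (show pauliWt (R + E + F) ≤ 2 * (pauliWt E + pauliWt F) by omega)
    linarith
  refine le_trans (Nat.cast_le.2 (Nat.sInf_le ⟨_, hmem, ?_⟩)) hFu
  rw [← add_assoc, pauli_add_self, zero_add]

/-! ### The double product code: soundness, distance and metachecks. -/

section Double

variable {c₀ c₁ : Type} [Fintype c₀] [Fintype c₁] [DecidableEq c₀] [DecidableEq c₁]
  {δ : Matrix c₁ c₀ (ZMod 2)} {δ' : Matrix c₀ c₁ (ZMod 2)} {d : ℕ∞}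

theorem doubleChecks_isSound (hδ : δ * δ' = 1)
    (hd : ∀ v, δ *ᵥ v = 0 → (hammingNorm v : ℕ∞) < d → v = 0) :
    IsSound (doubleChecks δ) d (fun x => (x : ℝ) ^ 3 / 4) := by
  refine ⟨by simp, fun E hE => ?_⟩
  have h := isSoundComplex_tilde hδ hd
  have h' := isSoundComplex_tilde_transpose hδ hd
  rw [doubleChecks, syndrome_cssChecks, hammingNorm_sumElim] at *
  obtain ⟨e, he, hew⟩ := h.breve0_sound h' E.1
    (lt_of_le_of_lt (Nat.cast_le.2 (Nat.le_add_right _ _)) hE)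
  obtain ⟨f, hf, hfw⟩ := h.breveNeg1_sound h' E.2
    (lt_of_le_of_lt (Nat.cast_le.2 (Nat.le_add_left _ _)) hE)
  refine ⟨(e, f), by rw [syndrome_cssChecks, he, hf], ?_⟩
  have hw := pauliWt_le (e, f)
  generalize hammingNorm (breve0 (tildeNeg1 δ) (tilde0 δ) *ᵥ E.1) = s at *
  generalize hammingNorm ((breveNeg1 (tildeNeg1 δ) (tilde0 δ))ᵀ *ᵥ E.2) = t at *
  -- The two error types are corrected separately; superadditivity of the cube combines the bounds.
  have h4 : 4 * pauliWt (e, f) ≤ (s + t) ^ 3 := by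
    have : s ^ 3 + t ^ 3 ≤ (s + t) ^ 3 :=
      (Nat.le_add_right _ (3 * s * t * (s + t))).trans_eq (by ring)
    simp only at hw
    omega
  have h5 : (4 : ℝ) * pauliWt (e, f) ≤ (s + t) ^ 3 := by exact_mod_cast h4
  push_cast
  linarith

theorem doubleChecks_mem_stabiliser (hδ : δ * δ' = 1)
    (hd : ∀ v, δ *ᵥ v = 0 → (hammingNorm v : ℕ∞) < d → v = 0)
    (E : Pauli (DoubleQubits c₀ c₁)) (hE : syndrome (doubleChecks δ) E = 0)
    (hw : (pauliWt E : ℕ∞) < d) : E ∈ stabiliser (doubleChecks δ) := by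
  rw [doubleChecks, syndrome_cssChecks] at hE
  rw [doubleChecks, stabiliser_cssChecks]
  exact ⟨(isSoundComplex_tilde hδ hd).breve0_distance E.1 (congrArg (· ∘ Sum.inl) hE)
      (lt_of_le_of_lt (Nat.cast_le.2 (hammingNorm_fst_le_pauliWt E)) hw),
    (isSoundComplex_tilde_transpose hδ hd).breveNeg1_distance E.2 (congrArg (· ∘ Sum.inr) hE)
      (lt_of_le_of_lt (Nat.cast_le.2 (hammingNorm_snd_le_pauliWt E)) hw)⟩

theorem doubleChecks_isSingleShot (hδ : δ * δ' = 1)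
    (hd : ∀ v, δ *ᵥ v = 0 → (hammingNorm v : ℕ∞) < d → v = 0) :
    IsSingleShot (doubleChecks δ) (((d : ℝ≥0∞) : EReal) / 2) (((d : ℝ≥0∞) : EReal) / 2)
      (fun x => (x : ℝ) ^ 3 / 4) :=
  (doubleChecks_isSound hδ hd).isSingleShot monotoneOn_cube_div_four
    (doubleChecks_mem_stabiliser hδ hd)

theorem breve_tilde_mul (hδ : δ * δ' = 1) :
    breve0 (tildeNeg1 δ) (tilde0 δ) * breveNeg1 (tildeNeg1 δ) (tilde0 δ) = 0 :=
  -- With `d = 0` the distance hypothesis is vacuous; only the algebraic fields of the structure are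
  -- needed.
  breve0_mul_breveNeg1 (isSoundComplex_tilde (d := 0) hδ fun _ _ h => absurd h not_lt_zero).zero

theorem commute_doubleChecks (hδ : δ * δ' = 1) (i j : DoubleZ c₀ c₁ ⊕ DoubleX c₀ c₁) :
    Commute (pauliOp (doubleChecks δ i)) (pauliOp (doubleChecks δ j)) := by
  have key : pauliAnti (doubleChecks δ i) (doubleChecks δ j) = 0 := by
    have hz := breve_tilde_mul hδ
    rcases i with u | v <;> rcases j with u' | v'
    · simp [pauliAnti, doubleChecks, cssChecks]
    · simp only [pauliAnti, doubleChecks, cssChecks, Sum.elim_inl, Sum.elim_inr, zero_dotProduct,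
        zero_add]
      exact congrFun (congrFun hz u) v'
    · simp only [pauliAnti, doubleChecks, cssChecks, Sum.elim_inl, Sum.elim_inr, zero_dotProduct,
        add_zero]
      rw [dotProduct_comm]
      exact congrFun (congrFun hz u') v
    · simp [pauliAnti, doubleChecks, cssChecks]
  have := pauliOp_mul_pauliOp (doubleChecks δ i) (doubleChecks δ j)
  rwa [key, bitSign_zero, one_smul] at this

theorem doubleMetachecks_mulVec_syndrome (hδ : δ * δ' = 1) (E : Pauli (DoubleQubits c₀ c₁)) :
    doubleMetachecks δ *ᵥ syndrome (doubleChecks δ) E = 0 := by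
  have h := isSoundComplex_tilde (d := 0) hδ fun _ _ h => absurd h not_lt_zero
  rw [doubleChecks, syndrome_cssChecks, doubleMetachecks, Matrix.fromBlocks_mulVec,
    Sum.elim_comp_inl, Sum.elim_comp_inr]
  simp only [Matrix.mulVec_mulVec, breve1_mul_breve0 h.zero, breveNeg1_mul_breveNeg2 h.zero,
    Matrix.zero_mul, Matrix.zero_mulVec, add_zero]
  exact Sum.elim_zero_zero

theorem singleShotDistance_doubleChecks (hδ : δ * δ' = 1) :
    singleShotDistance (doubleChecks δ) (doubleMetachecks δ) = ⊤ := by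
  have h := isSoundComplex_tilde (d := 0) hδ fun _ _ h => absurd h not_lt_zero
  have h' := isSoundComplex_tilde_transpose (d := 0) hδ fun _ _ h => absurd h not_lt_zero
  refine iInf₂_eq_top.2 fun s hs => absurd ?_ hs.2
  obtain ⟨p, q, rfl⟩ := sumElim_cases s
  have h0 := hs.1
  rw [doubleMetachecks, Matrix.fromBlocks_mulVec, Sum.elim_comp_inl, Sum.elim_comp_inr,
    Matrix.zero_mulVec, Matrix.zero_mulVec, zero_add, add_zero] at h0
  obtain ⟨e, rfl⟩ := h.breve1_exact p (congrArg (· ∘ Sum.inl) h0)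
  obtain ⟨f, rfl⟩ := h'.breveNeg2_exact q (congrArg (· ∘ Sum.inr) h0)
  exact ⟨(e, f), by rw [doubleChecks, syndrome_cssChecks]⟩

end Double

/-! ### Number of qubits, logical dimension and redundancy. -/

section Parameters

variable {n m : ℕ} {δ : Matrix (Fin m) (Fin n) (ZMod 2)} {δ' : Matrix (Fin n) (Fin m) (ZMod 2)}

theorem card_doubleQubits (n m : ℕ) :
    Fintype.card (DoubleQubits (Fin n) (Fin m)) = n ^ 4 + 4 * n ^ 2 * m ^ 2 + m ^ 4 := by
  simp only [Fintype.card_sum, Fintype.card_prod, Fintype.card_fin]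
  ring

theorem rank_breve_tilde (hδ : δ * δ' = 1) :
    (breve0 (tildeNeg1 δ) (tilde0 δ)).rank + n ^ 2 * m ^ 2 = 2 * (n * m) * (n ^ 2 + m ^ 2) ∧
    (breveNeg1 (tildeNeg1 δ) (tilde0 δ)).rank + n ^ 2 * m ^ 2 =
      2 * (n * m) * (n ^ 2 + m ^ 2) := by
  have h := isSoundComplex_tilde (d := 0) hδ fun _ _ h => absurd h not_lt_zero
  have h' := isSoundComplex_tilde_transpose (d := 0) hδ fun _ _ h => absurd h not_lt_zero
  have h₁ := h.rank_breve0
  have h₂ := h.rank_breveNeg1 h'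
  simp only [Fintype.card_sum, Fintype.card_prod, Fintype.card_fin] at h₁ h₂
  constructor <;> linarith

/-- The homology is concentrated in degree 0, so its dimension is the Euler characteristic. That of
the first product is `(n - m)²` and that of the second is its square. -/
theorem finrank_codeSpace_doubleChecks {k : ℕ} (hδ : δ * δ' = 1) (hk : n = m + k) :
    Module.finrank ℂ (codeSpace (doubleChecks δ)) = 2 ^ k ^ 4 := by
  obtain ⟨h₁, h₂⟩ := rank_breve_tilde hδ
  rw [doubleChecks, finrank_codeSpace_cssChecks _ _ (breve_tilde_mul hδ), card_doubleQubits]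
  congr 1
  have : n ^ 4 + 4 * n ^ 2 * m ^ 2 + m ^ 4 + 2 * (n ^ 2 * m ^ 2) =
      k ^ 4 + 2 * (2 * (n * m) * (n ^ 2 + m ^ 2)) := by
    subst hk; ring
  have h3 : 4 * n ^ 2 * m ^ 2 = 4 * (n ^ 2 * m ^ 2) := by ring
  omega

theorem redundancy_doubleChecks_lt_two (hδ : δ * δ' = 1) (hm : 0 < m) (hn : 0 < n) :
    0 < Module.finrank (ZMod 2) (stabiliser (doubleChecks δ)) ∧
      redundancy (doubleChecks δ) < 2 := by
  obtain ⟨h₁, h₂⟩ := rank_breve_tilde hδ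
  have hs : Module.finrank (ZMod 2) (stabiliser (doubleChecks δ)) + 2 * (n ^ 2 * m ^ 2) =
      4 * (n * m) * (n ^ 2 + m ^ 2) := by
    rw [doubleChecks, finrank_stabiliser_cssChecks]
    linarith
  have hc : Fintype.card (DoubleZ (Fin n) (Fin m) ⊕ DoubleX (Fin n) (Fin m)) =
      4 * (n * m) * (n ^ 2 + m ^ 2) := by
    simp only [Fintype.card_sum, Fintype.card_prod, Fintype.card_fin]
    ring
  have hp : 0 < n * m := Nat.mul_pos hn hm
  -- There are `4nm(n² + m²)` checks with `2n²m²` independent relations; redundancy below 2 means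
  -- that fewer than half of the checks are dependent, which follows from `nm < n² + m²`.
  have hlt : 2 * (2 * (n ^ 2 * m ^ 2)) < 4 * (n * m) * (n ^ 2 + m ^ 2) := by
    have : n * m < n ^ 2 + m ^ 2 := by nlinarith [sq_nonneg ((n : ℤ) - m)]
    nlinarith
  have hpos : 0 < Module.finrank (ZMod 2) (stabiliser (doubleChecks δ)) := by omega
  refine ⟨hpos, ?_⟩
  rw [redundancy, hc, div_lt_iff₀ (by exact_mod_cast hpos)]
  have : 4 * (n * m) * (n ^ 2 + m ^ 2) <
      2 * Module.finrank (ZMod 2) (stabiliser (doubleChecks δ)) := by omega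
  exact_mod_cast this

theorem isQuantumCode_doubleChecks {k : ℕ} {d : ℕ∞} (hδ : δ * δ' = 1) (hk : n = m + k)
    (hd : ∀ v, δ *ᵥ v = 0 → (hammingNorm v : ℕ∞) < d → v = 0) :
    ∃ dQ : ℕ∞, d ≤ dQ ∧ IsQuantumCode (doubleChecks δ) (doubleMetachecks δ)
      (n ^ 4 + 4 * n ^ 2 * m ^ 2 + m ^ 4) (k ^ 4) dQ ⊤ := by
  have hdim := finrank_codeSpace_doubleChecks hδ hk
  refine ⟨qubitDistance (doubleChecks δ), le_iInf₂ fun P hP => ?_,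
    ⟨commute_doubleChecks hδ, doubleMetachecks_mulVec_syndrome hδ, card_doubleQubits n m, hdim, rfl,
      singleShotDistance_doubleChecks hδ⟩⟩
  by_contra! hlt
  refine hP.2 (doubleChecks_mem_stabiliser hδ hd P (hP.1.syndrome_eq_zero fun h => ?_) hlt)
  rw [h, finrank_bot] at hdim
  exact (pow_pos (by norm_num : 0 < 2) _).ne hdim

end Parameters

/-! ### Minimal parity check matrices of a classical code. -/

section Classical

variable {n m : ℕ} {C : Submodule (ZMod 2) (Fin n → ZMod 2)}
  {δ : Matrix (Fin m) (Fin n) (ZMod 2)}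

theorem IsMinimalParityCheck.exists_rightInverse (h : IsMinimalParityCheck δ C) :
    ∃ δ' : Matrix (Fin n) (Fin m) (ZMod 2), δ * δ' = 1 := by
  rw [← Matrix.mulVec_surjective_iff_exists_right_inverse]
  have hr : δ.rank = m := by simpa using LinearIndependent.rank_matrix h.2
  have : LinearMap.range δ.mulVecLin = ⊤ := by
    apply Submodule.eq_top_of_finrank_eq
    rw [Module.finrank_fintype_fun_eq_card, Fintype.card_fin]
    exact hr
  exact LinearMap.range_eq_top.1 this

theorem IsMinimalParityCheck.length_eq (h : IsMinimalParityCheck δ C) :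
    n = m + Module.finrank (ZMod 2) C := by
  have hr : δ.rank = m := by simpa using LinearIndependent.rank_matrix h.2
  have hC : C = LinearMap.ker δ.mulVecLin := Submodule.ext h.1
  have := LinearMap.finrank_range_add_finrank_ker δ.mulVecLin
  rw [Module.finrank_fintype_fun_eq_card, Fintype.card_fin, ← hC] at this
  rw [Matrix.rank] at hr
  omega

theorem IsParityCheck.eq_zero_of_lt (h : IsParityCheck δ C) (v : Fin n → ZMod 2) (hv : δ *ᵥ v = 0)
    (hlt : (hammingNorm v : ℕ∞) < minDistance C) : v = 0 := by
  by_contra h0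
  exact absurd hlt (not_lt.2 (iInf₂_le v ⟨(h v).2 hv, h0⟩))

theorem linearIndependent_row_of_rightInverse {δ' : Matrix (Fin n) (Fin m) (ZMod 2)}
    (h : δ * δ' = 1) : LinearIndependent (ZMod 2) (fun i => δ i) := by
  refine Matrix.vecMul_injective_iff.1 fun v w hvw => ?_
  have := congrArg (Matrix.vecMul · δ') hvw
  simpa [Matrix.vecMul_vecMul, h] using this

variable (C) in
theorem exists_isMinimalParityCheck :
    ∃ (m : ℕ) (δ : Matrix (Fin m) (Fin n) (ZMod 2)), IsMinimalParityCheck δ C := by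
  -- The quotient map by `C`, written in a basis, has kernel `C`, and its surjectivity makes the
  -- rows independent.
  let b := Module.finBasis (ZMod 2) ((Fin n → ZMod 2) ⧸ C)
  let f := b.equivFun.toLinearMap ∘ₗ C.mkQ
  have hf : Function.Surjective f := b.equivFun.surjective.comp C.mkQ_surjective
  have hmul : ∀ v, LinearMap.toMatrix' f *ᵥ v = f v := fun v => LinearMap.toMatrix'_mulVec f v
  obtain ⟨δ', h⟩ := Matrix.mulVec_surjective_iff_exists_right_inverse.1
    (show Function.Surjective (LinearMap.toMatrix' f).mulVec from fun w => by
      obtain ⟨v, hv⟩ := hf w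
      exact ⟨v, (hmul v).trans hv⟩)
  refine ⟨_, LinearMap.toMatrix' f, fun v => ?_, linearIndependent_row_of_rightInverse h⟩
  rw [hmul, LinearMap.comp_apply, LinearEquiv.coe_coe, LinearEquiv.map_eq_zero_iff,
    Submodule.mkQ_apply, Submodule.Quotient.mk_eq_zero]

theorem IsParityCheck.exists_minimal_selection {r : ℕ} {h : Matrix (Fin r) (Fin n) (ZMod 2)}
    (hC : IsParityCheck h C) :
    ∃ (m : ℕ) (φ : Fin m → Fin r), IsMinimalParityCheck (h.submatrix φ id) C := by
  obtain ⟨κ, a, ha, hspan, hli⟩ := exists_linearIndependent' (ZMod 2) (fun i => h i)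
  have : Finite κ := Finite.of_injective a ha
  let e := (Finite.equivFin κ).symm
  refine ⟨_, a ∘ e, fun v => ?_, hli.comp e e.injective⟩
  rw [hC v]
  constructor
  · intro hv
    funext i
    exact congrFun hv (a (e i))
  · intro hv
    funext i
    have hi : h i ∈ Submodule.span (ZMod 2) (Set.range ((fun i => h i) ∘ a)) :=
      hspan ▸ Submodule.subset_span ⟨i, rfl⟩
    show h i ⬝ᵥ v = 0
    generalize h i = y at hi
    induction hi using Submodule.span_induction with
    | mem y hy =>
      obtain ⟨j, rfl⟩ := hy
      have := congrFun hv (e.symm j)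
      simpa [Matrix.mulVec] using this
    | zero => exact zero_dotProduct v
    | add y z _ _ hy hz => rw [add_dotProduct, hy, hz, add_zero]
    | smul c y _ hy => rw [smul_dotProduct, hy, smul_zero]

end Classical

/-! ### Row and column weights under the two products. -/

section RowWeight

variable {a b c : Type}

/-- All rows of the matrix have weight at most `w`. -/
def RowWeightLE [Fintype b] (M : Matrix a b (ZMod 2)) (w : ℕ) : Prop := ∀ i, hammingNorm (M i) ≤ w

theorem RowWeightLE.fromRows [Fintype c] {A : Matrix a c (ZMod 2)} {B : Matrix b c (ZMod 2)} {w : ℕ}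
    (hA : RowWeightLE A w) (hB : RowWeightLE B w) : RowWeightLE (Matrix.fromRows A B) w
  | Sum.inl i => hA i
  | Sum.inr i => hB i

theorem RowWeightLE.fromCols [Fintype b] [Fintype c] {A : Matrix a b (ZMod 2)} {B : Matrix a c (ZMod 2)} {w t : ℕ}
    (hA : RowWeightLE A w) (hB : RowWeightLE B t) :
    RowWeightLE (Matrix.fromCols A B) (w + t) := fun i => by
  have : Matrix.fromCols A B i = Sum.elim (A i) (B i) := by
    funext j; rcases j with j | j <;> rfl
  rw [this, hammingNorm_sumElim]
  exact Nat.add_le_add (hA i) (hB i)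

theorem RowWeightLE.mono [Fintype b] {A : Matrix a b (ZMod 2)} {w t : ℕ} (h : RowWeightLE A w) (hw : w ≤ t) :
    RowWeightLE A t := fun i => (h i).trans hw

theorem rowWeightLE_zero [Fintype b] : RowWeightLE (0 : Matrix a b (ZMod 2)) 0 :=
  fun _ => hammingNorm_zero.le

theorem RowWeightLE.kronecker_one [Fintype b] [Fintype c] [DecidableEq c] {A : Matrix a b (ZMod 2)} {w : ℕ}
    (h : RowWeightLE A w) : RowWeightLE (A ⊗ₖ (1 : Matrix c c (ZMod 2))) w := by
  rintro ⟨i, j⟩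
  refine le_trans (Finset.card_le_card_of_injOn Prod.fst ?_ ?_) (h i)
  · rintro ⟨k, l⟩ hk
    simp only [Finset.coe_filter, Finset.mem_univ, true_and, Set.mem_ofPred_eq,
      Matrix.kroneckerMap_apply, ne_eq, mul_eq_zero, not_or] at hk ⊢
    exact hk.1
  · rintro ⟨k, l⟩ hk ⟨k', l'⟩ hk' rfl
    simp only [Finset.coe_filter, Finset.mem_univ, true_and, Set.mem_ofPred_eq,
      Matrix.kroneckerMap_apply, ne_eq, mul_eq_zero, not_or] at hk hk'
    have h₁ : j = l := by by_contra hn; exact hk.2 (Matrix.one_apply_ne hn)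
    have h₂ : j = l' := by by_contra hn; exact hk'.2 (Matrix.one_apply_ne hn)
    rw [← h₁, ← h₂]

theorem RowWeightLE.one_kronecker [Fintype b] [Fintype c] [DecidableEq c] {A : Matrix a b (ZMod 2)} {w : ℕ}
    (h : RowWeightLE A w) : RowWeightLE ((1 : Matrix c c (ZMod 2)) ⊗ₖ A) w := by
  rintro ⟨j, i⟩
  refine le_trans (Finset.card_le_card_of_injOn Prod.snd ?_ ?_) (h i)
  · rintro ⟨l, k⟩ hk
    simp only [Finset.coe_filter, Finset.mem_univ, true_and, Set.mem_ofPred_eq,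
      Matrix.kroneckerMap_apply, ne_eq, mul_eq_zero, not_or] at hk ⊢
    exact hk.2
  · rintro ⟨l, k⟩ hk ⟨l', k'⟩ hk' rfl
    simp only [Finset.coe_filter, Finset.mem_univ, true_and, Set.mem_ofPred_eq,
      Matrix.kroneckerMap_apply, ne_eq, mul_eq_zero, not_or] at hk hk'
    have h₁ : j = l := by by_contra hn; exact hk.1 (Matrix.one_apply_ne hn)
    have h₂ : j = l' := by by_contra hn; exact hk'.1 (Matrix.one_apply_ne hn)
    rw [← h₁, ← h₂]

theorem Matrix.transpose_kronecker_one [DecidableEq c] (A : Matrix a b (ZMod 2)) :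
    (A ⊗ₖ (1 : Matrix c c (ZMod 2)))ᵀ = Aᵀ ⊗ₖ (1 : Matrix c c (ZMod 2)) := by
  rw [← Matrix.kroneckerMap_transpose, Matrix.transpose_one]

theorem Matrix.transpose_one_kronecker [DecidableEq c] (A : Matrix a b (ZMod 2)) :
    ((1 : Matrix c c (ZMod 2)) ⊗ₖ A)ᵀ = (1 : Matrix c c (ZMod 2)) ⊗ₖ Aᵀ := by
  rw [← Matrix.kroneckerMap_transpose, Matrix.transpose_one]

/-- All rows and all columns of the matrix have weight at most `w`. -/
def RowColWeightLE [Fintype a] [Fintype b] (M : Matrix a b (ZMod 2)) (w : ℕ) : Prop := RowWeightLE M w ∧ RowWeightLE Mᵀ w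

variable [Fintype a] [Fintype b] [Fintype c]

theorem RowColWeightLE.tildeNeg1 [DecidableEq a] [DecidableEq b] {δ : Matrix b a (ZMod 2)} {w : ℕ}
    (h : RowColWeightLE δ w) : RowColWeightLE (tildeNeg1 δ) (w + w) := by
  constructor
  · exact (h.2.one_kronecker.fromRows h.1.kronecker_one).mono (Nat.le_add_right _ _)
  · rw [_root_.tildeNeg1, Matrix.transpose_fromRows, Matrix.transpose_kronecker_one,
      Matrix.transpose_one_kronecker]
    exact RowWeightLE.fromCols (RowWeightLE.one_kronecker h.1) h.2.kronecker_one

theorem RowColWeightLE.tilde0 [DecidableEq a] [DecidableEq b] {δ : Matrix b a (ZMod 2)} {w : ℕ}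
    (h : RowColWeightLE δ w) : RowColWeightLE (tilde0 δ) (w + w) := by
  constructor
  · exact h.1.kronecker_one.fromCols h.2.one_kronecker
  · rw [_root_.tilde0, Matrix.transpose_fromCols, Matrix.transpose_kronecker_one,
      Matrix.transpose_one_kronecker]
    exact (h.2.kronecker_one.fromRows (RowWeightLE.one_kronecker h.1)).mono (Nat.le_add_right _ _)

variable [DecidableEq a] [DecidableEq b] [DecidableEq c] {A : Matrix b a (ZMod 2)}
  {B : Matrix c b (ZMod 2)} {w : ℕ}

theorem RowColWeightLE.breve0 (hA : RowColWeightLE A w) (hB : RowColWeightLE B w) :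
    RowColWeightLE (breve0 A B) (w + (w + w)) := by
  constructor
  -- Two blocks suffice here; the bound `3w` is used so that one constant also serves `breveNeg1`,
  -- whose transpose is estimated crudely by three blocks of columns.
  · refine RowWeightLE.mono (w := w + w) ?_ (Nat.le_add_left _ _)
    refine RowWeightLE.fromRows ?_ ?_
    · exact hA.1.kronecker_one.fromCols (hA.2.one_kronecker.fromCols rowWeightLE_zero)
    · rw [← zero_add (w + w)]
      exact rowWeightLE_zero.fromCols (hB.1.kronecker_one.fromCols hB.2.one_kronecker)
  · simp only [_root_.breve0, Matrix.transpose_fromRows, Matrix.transpose_fromCols,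
      Matrix.transpose_kronecker_one, Matrix.transpose_one_kronecker, Matrix.transpose_zero]
    refine (RowWeightLE.fromCols (w := w) (t := w)
      (hA.2.kronecker_one.fromRows ((RowWeightLE.one_kronecker hA.1).fromRows
        (rowWeightLE_zero.mono (Nat.zero_le _))))
      ((rowWeightLE_zero.mono (Nat.zero_le _)).fromRows
        (hB.2.kronecker_one.fromRows (RowWeightLE.one_kronecker hB.1)))).mono (Nat.le_add_left _ _)

theorem RowColWeightLE.breveNeg1 (hA : RowColWeightLE A w) (hB : RowColWeightLE B w) :
    RowColWeightLE (breveNeg1 A B) (w + (w + w)) := by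
  constructor
  · refine RowWeightLE.mono (w := w + w) ?_ (Nat.le_add_left _ _)
    refine RowWeightLE.fromRows ?_ (RowWeightLE.fromRows ?_ ?_)
    · exact (hA.2.one_kronecker.fromCols rowWeightLE_zero).mono (Nat.le_add_left _ _)
    · exact hA.1.kronecker_one.fromCols hB.2.one_kronecker
    · exact (rowWeightLE_zero.fromCols hB.1.kronecker_one).mono (by omega)
  · simp only [_root_.breveNeg1, Matrix.transpose_fromRows, Matrix.transpose_fromCols,
      Matrix.transpose_kronecker_one, Matrix.transpose_one_kronecker, Matrix.transpose_zero]
    have h₁ : RowWeightLE (Matrix.fromRows ((1 : Matrix a a (ZMod 2)) ⊗ₖ A)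
        (0 : Matrix (b × c) (a × a) (ZMod 2))) w :=
      (RowWeightLE.one_kronecker hA.1).fromRows (rowWeightLE_zero.mono (Nat.zero_le _))
    have h₂ : RowWeightLE (Matrix.fromRows (Aᵀ ⊗ₖ (1 : Matrix b b (ZMod 2)))
        ((1 : Matrix b b (ZMod 2)) ⊗ₖ B)) w :=
      hA.2.kronecker_one.fromRows (RowWeightLE.one_kronecker hB.1)
    have h₃ : RowWeightLE (Matrix.fromRows (0 : Matrix (a × b) (c × c) (ZMod 2))
        (Bᵀ ⊗ₖ (1 : Matrix c c (ZMod 2)))) w :=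
      (rowWeightLE_zero.mono (Nat.zero_le _)).fromRows hB.2.kronecker_one
    exact h₁.fromCols (h₂.fromCols h₃)

end RowWeight

section Ldpc

variable {cm c cp : Type} [Fintype cm] [Fintype c] [Fintype cp] {δm : Matrix c cm (ZMod 2)}
  {δ₀ : Matrix cp c (ZMod 2)} {w : ℕ}

theorem pauliWt_cssChecks_le (hm : RowColWeightLE δm w) (h₀ : RowColWeightLE δ₀ w) (i : cp ⊕ cm) :
    pauliWt (cssChecks δm δ₀ i) ≤ w := by
  refine (pauliWt_le _).trans ?_
  rcases i with u | v
  · show hammingNorm (0 : c → ZMod 2) + hammingNorm (δ₀ u) ≤ w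
    rw [hammingNorm_zero, zero_add]
    exact h₀.1 u
  · show hammingNorm (δmᵀ v) + hammingNorm (0 : c → ZMod 2) ≤ w
    rw [hammingNorm_zero, add_zero]
    exact hm.2 v

theorem card_cssChecks_acting_le (hm : RowColWeightLE δm w) (h₀ : RowColWeightLE δ₀ w) (q : c) :
    (Finset.univ.filter fun i => (cssChecks δm δ₀ i).1 q ≠ 0 ∨ (cssChecks δm δ₀ i).2 q ≠ 0).card ≤
      w + w := by
  have h := Nat.add_le_add (h₀.2 q) (hm.1 q)
  refine le_trans (le_of_eq ?_) h
  rw [hammingNorm, hammingNorm, Finset.card_filter, Finset.card_filter, Finset.card_filter,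
    Fintype.sum_sum_type]
  simp only [cssChecks, Sum.elim_inl, Sum.elim_inr, Pi.zero_apply, ne_eq, not_true_eq_false,
    false_or, or_false]
  rfl

theorem isLDPC_doubleChecks {ι : Type} {n m : ι → ℕ}
    (δ : ∀ i, Matrix (Fin (m i)) (Fin (n i)) (ZMod 2)) (w : ℕ)
    (h : ∀ i, RowColWeightLE (δ i) w) : IsLDPC fun i => doubleChecks (δ i) := by
  -- The first product gives `2w` and the second three times that; the doubling adds the `Z` checks
  -- and the `X` checks that meet a qubit.
  refine ⟨w + w + (w + w + (w + w)) + (w + w + (w + w + (w + w))), fun i => ?_⟩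
  have hm := (h i).tildeNeg1.breveNeg1 (h i).tilde0
  have h₀ := (h i).tildeNeg1.breve0 (h i).tilde0
  exact ⟨fun c => (pauliWt_cssChecks_le hm h₀ c).trans (Nat.le_add_right _ _),
    card_cssChecks_acting_le hm h₀⟩

theorem RowColWeightLE.submatrix {r n m : ℕ} {h : Matrix (Fin r) (Fin n) (ZMod 2)} {w : ℕ}
    (hw : RowColWeightLE h w) {φ : Fin m → Fin r} (hφ : Function.Injective φ) :
    RowColWeightLE (h.submatrix φ id) w := by
  refine ⟨fun i => hw.1 (φ i), fun j => le_trans ?_ (hw.2 j)⟩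
  refine Finset.card_le_card_of_injOn φ (fun i hi => ?_) hφ.injOn
  exact Finset.mem_filter.2 ⟨Finset.mem_univ _, (Finset.mem_filter.1 hi).2⟩

end Ldpc

/-! ### Good single-shot families. -/

section Family

theorem coe_le_half {D : ℕ∞} {r : ℝ} (h : ((2 * r : ℝ) : EReal) ≤ ((D : ℝ≥0∞) : EReal)) :
    (r : EReal) ≤ ((D : ℝ≥0∞) : EReal) / 2 := by
  have h2 : ((2 : ℝ) : EReal) = 2 := rfl
  rw [← h2, EReal.le_div_iff_mul_le (by exact_mod_cast two_pos) (EReal.coe_ne_top 2),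
    ← EReal.coe_mul, mul_comm]
  exact h

theorem one_le_minDistance {n : ℕ} (C : Submodule (ZMod 2) (Fin n → ZMod 2)) :
    ((1 : ℝ) : EReal) ≤ ((minDistance C : ℝ≥0∞) : EReal) := by
  have h : (1 : ℕ∞) ≤ minDistance C := le_iInf₂ fun v hv => by
    exact_mod_cast hammingNorm_pos_iff.2 hv.2
  have h' : (1 : ℝ≥0∞) ≤ (minDistance C : ℝ≥0∞) := by exact_mod_cast h
  exact EReal.coe_ennreal_le_coe_ennreal_iff.2 h'

theorem rpow_quarter_le {n m N : ℕ} (hmn : m ≤ n) (hN : N = n ^ 4 + 4 * n ^ 2 * m ^ 2 + m ^ 4)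
    {a : ℝ} (ha : 0 < a) : (N : ℝ) ^ (a / 4) ≤ (6 : ℝ) ^ (a / 4) * (n : ℝ) ^ a := by
  have h₁ : N ≤ 6 * n ^ 4 := by
    have h2 : m ^ 2 ≤ n ^ 2 := Nat.pow_le_pow_left hmn 2
    have h4 : m ^ 4 ≤ n ^ 4 := Nat.pow_le_pow_left hmn 4
    have : n ^ 2 * m ^ 2 ≤ n ^ 2 * n ^ 2 := Nat.mul_le_mul_left _ h2
    rw [hN]
    nlinarith
  have h₂ : (N : ℝ) ≤ 6 * (n : ℝ) ^ 4 := by exact_mod_cast h₁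
  refine (Real.rpow_le_rpow (Nat.cast_nonneg _) h₂ (by positivity)).trans_eq ?_
  rw [Real.mul_rpow (by norm_num) (by positivity), ← Real.rpow_natCast, ← Real.rpow_mul
    (Nat.cast_nonneg _)]
  congr 2
  push_cast
  ring

theorem isGoodSingleShotFamily_doubleChecks (n m : ℕ → ℕ) (d : ℕ → ℕ∞)
    (C : ∀ i, Submodule (ZMod 2) (Fin (n i) → ZMod 2))
    (δ : ∀ i, Matrix (Fin (m i)) (Fin (n i)) (ZMod 2))
    (hn : Filter.Tendsto n Filter.atTop Filter.atTop) (hd : ∀ i, minDistance (C i) = d i)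
    (hδ : ∀ i, IsMinimalParityCheck (δ i) (C i)) {a c : ℝ} (ha : 0 < a) (hc : 0 < c) {n₀ : ℕ}
    (hdn : ∀ i, n₀ ≤ n i → ((c * (n i : ℝ) ^ a : ℝ) : EReal) ≤ ((d i : ℝ≥0∞) : EReal)) :
    IsGoodSingleShotFamily (fun i => doubleChecks (δ i)) := by
  refine ⟨Filter.tendsto_atTop_mono (fun i => ?_) hn, fun i => ((d i : ℝ≥0∞) : EReal) / 2,
    fun i => ((d i : ℝ≥0∞) : EReal) / 2, fun x => (x : ℝ) ^ 3 / 4, ?_,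
    ⟨Polynomial.C (1 / 4) * Polynomial.X ^ 3, fun x => ?_⟩, monotoneOn_cube_div_four, fun i => ?_⟩
  · rw [card_doubleQubits]
    have := Nat.le_self_pow (n := 4) (by norm_num) (n i)
    omega
  · have hpos : (0 : ℝ) < (n₀ + 1 : ℝ) ^ a := Real.rpow_pos_of_pos (by positivity) a
    have h6 : (0 : ℝ) < (6 : ℝ) ^ (a / 4) := Real.rpow_pos_of_pos (by norm_num) _
    -- The first entry serves lengths at least `n₀`. For shorter codes only `d ≥ 1` is available,
    -- and the second entry keeps `2β n ^ a` at most 1. The exponent is `a / 4` because the number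
    -- of qubits is of order `n ^ 4`.
    set β : ℝ := min (c / 2) (1 / (2 * (n₀ + 1 : ℝ) ^ a)) with hβ
    have hβ0 : 0 < β := lt_min (by positivity) (by positivity)
    refine ⟨β / (6 : ℝ) ^ (a / 4), a / 4, by positivity, by positivity, fun i => ?_⟩
    rw [and_self]
    apply coe_le_half
    have hN := rpow_quarter_le (by have := (hδ i).length_eq; omega)
      (card_doubleQubits (n i) (m i)) ha
    have hle : β / (6 : ℝ) ^ (a / 4) *
        (Fintype.card (DoubleQubits (Fin (n i)) (Fin (m i))) : ℝ) ^ (a / 4) ≤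
        β * (n i : ℝ) ^ a := by
      refine (mul_le_mul_of_nonneg_left hN (by positivity)).trans_eq ?_
      field_simp
    have hna : (0 : ℝ) ≤ (n i : ℝ) ^ a := Real.rpow_nonneg (Nat.cast_nonneg _) a
    rcases le_or_gt n₀ (n i) with h | h
    · refine le_trans (EReal.coe_le_coe_iff.2 ?_) (hdn i h)
      have : β * (n i : ℝ) ^ a ≤ c / 2 * (n i : ℝ) ^ a :=
        mul_le_mul_of_nonneg_right (min_le_left _ _) hna
      linarith
    · rw [← hd i]
      refine le_trans (EReal.coe_le_coe_iff.2 ?_) (one_le_minDistance (C i))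
      have h₁ : (n i : ℝ) ^ a ≤ (n₀ + 1 : ℝ) ^ a :=
        Real.rpow_le_rpow (Nat.cast_nonneg _) (by exact_mod_cast (by omega : n i ≤ n₀ + 1)) ha.le
      have h₂ : β * (n i : ℝ) ^ a ≤ 1 / (2 * (n₀ + 1 : ℝ) ^ a) * (n₀ + 1 : ℝ) ^ a :=
        mul_le_mul (min_le_right _ _) h₁ hna (by positivity)
      have h₃ : 1 / (2 * (n₀ + 1 : ℝ) ^ a) * (n₀ + 1 : ℝ) ^ a = 1 / 2 := by
        field_simp
      linarith
  · simp only [Polynomial.eval_mul, Polynomial.eval_C, Polynomial.eval_pow, Polynomial.eval_X]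
    ring
  · obtain ⟨δ', hδ'⟩ := (hδ i).exists_rightInverse
    exact doubleChecks_isSingleShot hδ' fun v hv hlt =>
      (hδ i).1.eq_zero_of_lt v hv (by rwa [hd i])

end Family

theorem theorem4 :
    -- a single classical code
    (∀ (n k : ℕ) (d : ℕ∞) (C : Submodule (ZMod 2) (Fin n → ZMod 2)), IsClassicalCode C k d →
      (∃ (m : ℕ) (δ : Matrix (Fin m) (Fin n) (ZMod 2)), IsMinimalParityCheck δ C) ∧
      ∀ (m : ℕ) (δ : Matrix (Fin m) (Fin n) (ZMod 2)), IsMinimalParityCheck δ C →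
        (∃ dQ : ℕ∞, d ≤ dQ ∧
          IsQuantumCode (doubleChecks δ) (doubleMetachecks δ)
            (n ^ 4 + 4 * n ^ 2 * (n - k) ^ 2 + (n - k) ^ 4) (k ^ 4) dQ ⊤) ∧
        IsSound (doubleChecks δ) d (fun x => (x : ℝ) ^ 3 / 4) ∧
        IsSingleShot (doubleChecks δ) (((d : ℝ≥0∞) : EReal) / 2) (((d : ℝ≥0∞) : EReal) / 2)
          (fun x => (x : ℝ) ^ 3 / 4) ∧
        (k < n → 0 < Module.finrank (ZMod 2) (stabiliser (doubleChecks δ)) ∧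
          redundancy (doubleChecks δ) < 2)) ∧
    -- classical LDPC check families (possibly with redundant checks) give quantum LDPC families
    (∀ (n r : ℕ → ℕ) (C : ∀ i, Submodule (ZMod 2) (Fin (n i) → ZMod 2))
      (h : ∀ i, Matrix (Fin (r i)) (Fin (n i)) (ZMod 2)),
      (∀ i, IsParityCheck (h i) (C i)) → IsClassicalLDPC h →
      (∀ i, ∃ (m : ℕ) (φ : Fin m → Fin (r i)),
        IsMinimalParityCheck ((h i).submatrix φ id) (C i)) ∧
      ∀ (m : ℕ → ℕ) (φ : ∀ i, Fin (m i) → Fin (r i)),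
        (∀ i, IsMinimalParityCheck ((h i).submatrix (φ i) id) (C i)) →
        IsLDPC (fun i => doubleChecks ((h i).submatrix (φ i) id))) ∧
    -- classical families with polynomially growing distance give good single-shot families
    (∀ (n m : ℕ → ℕ) (d : ℕ → ℕ∞) (C : ∀ i, Submodule (ZMod 2) (Fin (n i) → ZMod 2))
      (δ : ∀ i, Matrix (Fin (m i)) (Fin (n i)) (ZMod 2)),
      Filter.Tendsto n Filter.atTop Filter.atTop →
      (∀ i, minDistance (C i) = d i) → (∀ i, IsMinimalParityCheck (δ i) (C i)) →
      (∃ a c : ℝ, 0 < a ∧ 0 < c ∧ ∃ n₀ : ℕ, ∀ i, n₀ ≤ n i →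
        ((c * (n i : ℝ) ^ a : ℝ) : EReal) ≤ ((d i : ℝ≥0∞) : EReal)) →
      IsGoodSingleShotFamily (fun i => doubleChecks (δ i))) := by
  refine ⟨fun n k d C hC => ⟨exists_isMinimalParityCheck C, fun m δ hδ => ?_⟩,
    fun n r C h hC hw => ⟨fun i => (hC i).exists_minimal_selection, fun m φ hφ => ?_⟩, ?_⟩
  · obtain ⟨rfl, rfl⟩ := hC
    obtain ⟨δ', hδ'⟩ := hδ.exists_rightInverse
    have hk := hδ.length_eq
    have hd := hδ.1.eq_zero_of_lt
    have hm : n - Module.finrank (ZMod 2) C = m := by omega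
    rw [hm]
    exact ⟨isQuantumCode_doubleChecks hδ' hk hd, doubleChecks_isSound hδ' hd,
      doubleChecks_isSingleShot hδ' hd,
      fun hlt => redundancy_doubleChecks_lt_two hδ' (by omega) (by omega)⟩
  · obtain ⟨w, hw⟩ := hw
    refine isLDPC_doubleChecks _ w fun i => RowColWeightLE.submatrix (hw i) fun p q hpq => ?_
    -- Independent rows are distinct, so no row is selected twice; otherwise repetitions could spoil
    -- the column weights.
    exact (hφ i).2.injective (funext fun j => congrArg (fun t => h i t j) hpq)
  · rintro n m d C δ hn hd hδ ⟨a, c, ha, hc, n₀, hdn⟩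
    exact isGoodSingleShotFamily_doubleChecks n m d C δ hn hd hδ ha hc hdn
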